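/- Let \(\mathbb F\) be a field of characteristic different from \(2\), let \(n\ge 0\) be an integer, and let \(E=E^{(n)}=\bigoplus_{i\ge 0}E_i\) be the Grassmann (exterior) algebra of an \(n\)-dimensional \(\mathbb F\)-vector space, graded by degree; put \(E_{\overline 0}=\bigoplus_{i\ \mathrm{even}}E_i\). Subalgebras need not contain \(1\). A commutative subalgebra of \(E\) is called maximal if it is not properly contained in another commutative subalgebra of \(E\), and maximal dimensional if its dimension is the largest among all commutative subalgebras of \(E\). A subspace \(C\subseteq E\) is square zero if \(cd=0\) for all \(c,d\in C\). An odd intersecting system is a family \(\mathcal F\) of subsets of \(\{1,\dots,n\}\) such that \(|X|\) is odd for all \(X\in\mathcal F\) and \(X\cap Y\neq\emptyset\) for all \(X,Y\in\mathcal F\). (i) The maximal dimension of a commutative subalgebra of \(E^{(n)}\) is \(\dim(E_{\overline 0})+|\mathcal F|\), where \(\mathcal F\) is an odd intersecting system of maximal possible size. Explicitly, this dimension is \[ \begin{array}{ll} 3\cdot 2^{n-2} & \text{if } n\ge 2 \text{ is even};\\ 2^{n-1}+\sum_{l=k}^{2k}\binom{n}{2l+1} & \text{if } n=4k+1;\\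 2^{n-1}+\binom{n-1}{2k}+\sum_{l=k}^{2k}\binom{n}{2l+3} & \text{if } n=4k+3. \end{array} \] (ii) If \(n\) is even, all maximal commutative subalgebras of \(E^{(n)}\) have the same dimension; if moreover \(n>2\), they are not all isomorphic as \(\mathbb F\)-algebras. (iii) If \(n=4k+1\), there is a unique maximal dimensional commutative subalgebra of \(E^{(n)}\), namely \(E_{\overline 0}\oplus\bigoplus_{i>n/2,\ i\ \mathrm{odd}}E_i\). (iv) If \(n=4k+3\), the maximal dimensional commutative subalgebras of \(E^{(n)}\) are exactly the subspaces of the form \(E_{\overline 0}\oplus C\oplus\bigoplus_{i>n/2,\ i\ \mathrm{odd}}E_i\), where \(C\subseteq E_{2k+1}\) is a square zero subspace of dimension \(\binom{n-1}{2k}\). (v) If \(n\ge 5\) is odd, there exist maximal commutative subalgebras of \(E^{(n)}\) that are not maximal dimensional. -/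

import Mathlib

/-- The Grassmann (exterior) algebra `E⁽ⁿ⁾` of the `n`-dimensional vector space `Fⁿ`. -/
abbrev Grassmann (F : Type*) [Field F] (n : ℕ) : Type _ :=
  ExteriorAlgebra F (Fin n → F)

namespace Grassmann

/-- The degree `i` homogeneous component `E_i`, the `i`-th exterior power of `Fⁿ` inside `E⁽ⁿ⁾`. -/
abbrev component (F : Type*) [Field F] (n i : ℕ) : Submodule F (Grassmann F n) :=
  ⋀[F]^i (Fin n → F)

/-- The even part: the sum of the components of even degree. It is a direct sum, since
`E⁽ⁿ⁾` is graded by its homogeneous components; the same holds for every sum of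
subspaces of distinct components below. -/
def evenPart (F : Type*) [Field F] (n : ℕ) : Submodule F (Grassmann F n) :=
  ⨆ (i : ℕ) (_ : Even i), component F n i

/-- The sum of the components `E_i` with `i` odd and `n / 2 < i`. -/
def highOddPart (F : Type*) [Field F] (n : ℕ) : Submodule F (Grassmann F n) :=
  ⨆ (i : ℕ) (_ : Odd i ∧ n < 2 * i), component F n i

/-- A subspace in which any two elements have product zero. -/
def IsSquareZero {F : Type*} [Field F] {n : ℕ} (C : Submodule F (Grassmann F n)) : Prop :=
  ∀ x ∈ C, ∀ y ∈ C, x * y = 0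

/-- A commutative subalgebra. Subalgebras are not required to contain the identity. -/
def IsCommSubalgebra {F : Type*} [Field F] {n : ℕ}
    (A : NonUnitalSubalgebra F (Grassmann F n)) : Prop :=
  ∀ x ∈ A, ∀ y ∈ A, x * y = y * x

/-- A maximal commutative subalgebra: one that is not properly contained in another. -/
def IsMaximalComm {F : Type*} [Field F] {n : ℕ}
    (A : NonUnitalSubalgebra F (Grassmann F n)) : Prop :=
  Maximal IsCommSubalgebra A

/-- A commutative subalgebra whose dimension is the largest possible. -/
def IsMaxDimComm {F : Type*} [Field F] {n : ℕ}
    (A : NonUnitalSubalgebra F (Grassmann F n)) : Prop :=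
  IsCommSubalgebra A ∧
    ∀ B : NonUnitalSubalgebra F (Grassmann F n), IsCommSubalgebra B →
      Module.finrank F B ≤ Module.finrank F A

/-- Isomorphism of (not necessarily unital) `F`-algebras. If both algebras happen to have an
identity, such a bijection automatically preserves it. -/
def AreIsomorphic {F : Type*} [Field F] {n : ℕ}
    (A B : NonUnitalSubalgebra F (Grassmann F n)) : Prop :=
  ∃ f : A →ₙₐ[F] B, Function.Bijective f

/-- The set of dimensions of the commutative subalgebras of `E⁽ⁿ⁾`. -/
def commDims (F : Type*) [Field F] (n : ℕ) : Set ℕ :=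
  {d | ∃ A : NonUnitalSubalgebra F (Grassmann F n),
    IsCommSubalgebra A ∧ Module.finrank F A = d}

end Grassmann

/-- An odd intersecting system: a family of sets of odd size, any two of which meet. -/
def IsOddIntersecting {n : ℕ} (S : Finset (Finset (Fin n))) : Prop :=
  (∀ X ∈ S, ∀ Y ∈ S, (X ∩ Y).Nonempty) ∧ ∀ X ∈ S, Odd X.card

/-- The set of sizes of the odd intersecting systems of subsets of an `n`-element set. -/
def oddIntersectingSizes (n : ℕ) : Set ℕ :=
  {m | ∃ S : Finset (Finset (Fin n)), IsOddIntersecting S ∧ S.card = m}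

/-! Even elements are central and odd elements anticommute, so the commutator of `x` and `y` is
twice the product of their odd parts (`mul_sub_mul_eq`). In characteristic other than 2,
commutativity of a subalgebra therefore means that its odd projection is square zero, and every
square zero space lies in a commutative subalgebra containing the even part. The maximal dimension
thus reduces to that of square zero spaces of odd elements. Leading monomials for an additive weight
turn such a space into an odd intersecting system at least as large as its dimension, and an
intersecting system spans a square zero coordinate space (`isGreatest_commDims`).

The rest is extremal set theory. For even `n` a system contains at most one of each complementary
pair. For `n = 2 * h + 1`, double counting trades sets smaller than `h` for strictly more large
sets, and Erdős–Ko–Rado bounds the layer of size `h`, which matters only for odd `h`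
(`IsOddIntersecting.card_le_and`). Strictness forces the odd part of an extremal subalgebra into
degrees at least `h`, which gives the classification `isMaxDimComm_iff_odd`; a maximal subalgebra
containing a degree 1 element is then too small once `n ≥ 5`.

For even `n`, a maximal subalgebra is the orthogonal of its own odd part under the top-coefficient
form, which fixes its dimension. Two of them are told apart by the dimension of spaces of vectors on
which the whole subalgebra acts by scalars (`exists_not_areIsomorphic`). -/

namespace Grassmann

open Module

variable {F : Type*} [Field F] {n : ℕ}

/-! ### Monomials, structure constants and coordinate subspaces. -/

/-- The monomial basis of the Grassmann algebra, indexed by the subsets of `{0, …, n - 1}`. -/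
noncomputable def mon (F : Type*) [Field F] (n : ℕ) : Basis (Finset (Fin n)) F (Grassmann F n) :=
  (Pi.basisFun F (Fin n)).ExteriorAlgebra

/-- The coordinate functional of a monomial. -/
noncomputable def coef (X : Finset (Fin n)) : Grassmann F n →ₗ[F] F := (mon F n).coord X

instance : FiniteDimensional F (Grassmann F n) := (mon F n).finiteDimensional_of_finite

theorem coef_mon (X Y : Finset (Fin n)) : coef X (mon F n Y) = if Y = X then 1 else 0 := by
  simp [coef, Finsupp.single_apply]

theorem ext_coef {x y : Grassmann F n} (h : ∀ X, coef X x = coef X y) : x = y :=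
  (mon F n).ext_elem h

theorem sum_coef (x : Grassmann F n) : ∑ X, coef X x • mon F n X = x :=
  (mon F n).sum_repr x

theorem mon_mul_of_not_disjoint {X Y : Finset (Fin n)} (h : ¬ Disjoint X Y) :
    mon F n X * mon F n Y = 0 :=
  ExteriorAlgebra.basis_mul_of_not_disjoint (Pi.basisFun F (Fin n))
    (⟨X, rfl⟩ : Set.powersetCard (Fin n) X.card) (⟨Y, rfl⟩ : Set.powersetCard (Fin n) Y.card) h

theorem exists_mon_mul {X Y : Finset (Fin n)} (h : Disjoint X Y) :
    ∃ u : ℤˣ, mon F n X * mon F n Y = u • mon F n (X ∪ Y) := by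
  let s : Set.powersetCard (Fin n) X.card := ⟨X, rfl⟩
  let t : Set.powersetCard (Fin n) Y.card := ⟨Y, rfl⟩
  have h' : Disjoint s.val t.val := h
  refine ⟨(Set.powersetCard.permOfDisjoint h').sign, ?_⟩
  have hst : (Set.powersetCard.disjUnion h' : Finset (Fin n)) = X ∪ Y := by
    ext a
    simp [Set.powersetCard.disjUnion, s, t]
  have := ExteriorAlgebra.basis_mul_of_disjoint (R := F) (Pi.basisFun F (Fin n)) s t h'
  rwa [hst] at this

/-- The structure constant of the product of two monomials. -/
noncomputable def sgn (F : Type*) [Field F] {n : ℕ} (X Y : Finset (Fin n)) : F :=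
  coef (X ∪ Y) (mon F n X * mon F n Y)

theorem sgn_eq_zero {X Y : Finset (Fin n)} (h : ¬ Disjoint X Y) : sgn F X Y = 0 := by
  rw [sgn, mon_mul_of_not_disjoint h, map_zero]

theorem sgn_ne_zero {X Y : Finset (Fin n)} (h : Disjoint X Y) : sgn F X Y ≠ 0 := by
  obtain ⟨u, hu⟩ := exists_mon_mul (F := F) h
  rw [sgn, hu]
  rcases Int.units_eq_one_or u with rfl | rfl <;> simp [coef_mon]

theorem mon_mul (X Y : Finset (Fin n)) :
    mon F n X * mon F n Y = sgn F X Y • mon F n (X ∪ Y) := by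
  by_cases h : Disjoint X Y
  · obtain ⟨u, hu⟩ := exists_mon_mul (F := F) h
    rw [sgn, hu]
    rcases Int.units_eq_one_or u with rfl | rfl <;> simp [coef_mon]
  · rw [sgn_eq_zero h, mon_mul_of_not_disjoint h, zero_smul]

theorem coef_mul (Z : Finset (Fin n)) (x y : Grassmann F n) :
    coef Z (x * y) = ∑ X, ∑ Y, if X ∪ Y = Z then coef X x * coef Y y * sgn F X Y else 0 := by
  conv_lhs => rw [← sum_coef x, ← sum_coef y]
  simp only [Finset.sum_mul, Finset.mul_sum, map_sum]
  rw [Finset.sum_comm]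
  refine Finset.sum_congr rfl fun X _ => Finset.sum_congr rfl fun Y _ => ?_
  rw [smul_mul_smul_comm, mon_mul, map_smul, map_smul, coef_mon]
  split_ifs <;> simp

/-- Only `X` is disjoint from `Xᶜ` and completes it to the full set, so multiplying by a
complementary monomial reads off a single coordinate. -/
theorem coef_mul_mon_compl (x : Grassmann F n) (X : Finset (Fin n)) :
    coef Finset.univ (x * mon F n Xᶜ) = coef X x * sgn F X Xᶜ := by
  rw [coef_mul, Finset.sum_eq_single X, Finset.sum_eq_single Xᶜ]
  · simp [coef_mon]
  · intro Y _ hY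
    simp [coef_mon, hY.symm]
  · simp
  · intro Y _ hY
    refine Finset.sum_eq_zero fun Z _ => ?_
    split_ifs with h
    · by_cases hZ : Z = Xᶜ
      · rw [sgn_eq_zero, mul_zero]
        subst hZ
        intro hd
        exact hY (IsCompl.of_eq (disjoint_iff.mp hd) h |>.eq_compl.trans (compl_compl X))
      · simp [coef_mon, Ne.symm hZ]
    · rfl
  · simp

/-- The coordinate subspace of the elements supported on a family of sets. -/
noncomputable def monSpan (F : Type*) [Field F] {n : ℕ} (S : Set (Finset (Fin n))) :
    Submodule F (Grassmann F n) where
  carrier := {x | ∀ X, X ∉ S → coef X x = 0}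
  add_mem' hx hy X hX := by rw [map_add, hx X hX, hy X hX, add_zero]
  zero_mem' X _ := map_zero _
  smul_mem' c x hx X hX := by rw [map_smul, hx X hX, smul_zero]

variable {S T : Set (Finset (Fin n))}

theorem mon_mem_monSpan {X : Finset (Fin n)} : mon F n X ∈ monSpan F S ↔ X ∈ S := by
  refine ⟨fun h => ?_, fun h Y hY => ?_⟩
  · by_contra hX
    simpa [coef_mon] using h X hX
  · rw [coef_mon, if_neg]
    rintro rfl
    exact hY h

theorem monSpan_eq_span (S : Set (Finset (Fin n))) :
    monSpan F S = Submodule.span F (mon F n '' S) := by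
  refine le_antisymm (fun x hx => ?_) (Submodule.span_le.mpr ?_)
  · rw [← sum_coef x]
    refine Submodule.sum_mem _ fun X _ => ?_
    by_cases hX : X ∈ S
    · exact Submodule.smul_mem _ _ (Submodule.subset_span ⟨X, hX, rfl⟩)
    · rw [hx X hX, zero_smul]
      exact zero_mem _
  · rintro _ ⟨X, hX, rfl⟩
    exact mon_mem_monSpan.mpr hX

theorem monSpan_mono (h : S ⊆ T) : monSpan F S ≤ monSpan F T :=
  fun _ hx X hX => hx X fun hS => hX (h hS)

theorem monSpan_iSup {ι : Sort*} (S : ι → Set (Finset (Fin n))) :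
    monSpan F (⋃ i, S i) = ⨆ i, monSpan F (S i) := by
  simp_rw [monSpan_eq_span, Set.image_iUnion, Submodule.span_iUnion]

theorem mem_monSpan_inter {x : Grassmann F n} (hS : x ∈ monSpan F S) (hT : x ∈ monSpan F T) :
    x ∈ monSpan F (S ∩ T) := fun X hX => by
  by_cases h : X ∈ S
  · exact hT X fun hT => hX ⟨h, hT⟩
  · exact hS X h

theorem disjoint_monSpan (h : Disjoint S T) : Disjoint (monSpan F S) (monSpan F T) := by
  refine Submodule.disjoint_def.mpr fun x hS hT => ext_coef fun X => ?_
  rw [map_zero]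
  exact mem_monSpan_inter hS hT X fun hX => Set.disjoint_left.mp h hX.1 hX.2

theorem finrank_monSpan (S : Finset (Finset (Fin n))) :
    finrank F (monSpan F (S : Set (Finset (Fin n)))) = S.card := by
  have h : LinearIndependent F fun X : S => mon F n X :=
    (mon F n).linearIndependent.comp _ Subtype.val_injective
  have hr : Set.range (fun X : S => mon F n X) = mon F n '' (S : Set (Finset (Fin n))) := by
    ext x
    simp
  rw [monSpan_eq_span, ← hr, finrank_span_eq_card h, Fintype.card_coe]

theorem mul_mem_monSpan {U : Set (Finset (Fin n))} {x y : Grassmann F n}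
    (hx : x ∈ monSpan F S) (hy : y ∈ monSpan F T)
    (h : ∀ X ∈ S, ∀ Y ∈ T, Disjoint X Y → X ∪ Y ∈ U) : x * y ∈ monSpan F U := by
  intro Z hZ
  rw [coef_mul]
  refine Finset.sum_eq_zero fun X _ => Finset.sum_eq_zero fun Y _ => ?_
  split_ifs with hXY
  · by_cases hX : X ∈ S
    · by_cases hY : Y ∈ T
      · rw [sgn_eq_zero, mul_zero]
        exact fun hd => hZ (hXY ▸ h X hX Y hY hd)
      · rw [hy Y hY, mul_zero, zero_mul]
    · rw [hx X hX, zero_mul, zero_mul]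
  · rfl

theorem mul_eq_zero_of_monSpan {x y : Grassmann F n}
    (hx : x ∈ monSpan F S) (hy : y ∈ monSpan F T)
    (h : ∀ X ∈ S, ∀ Y ∈ T, ¬ Disjoint X Y) : x * y = 0 := by
  have := mul_mem_monSpan (U := ∅) hx hy fun X hX Y hY hd => h X hX Y hY hd
  exact ext_coef fun X => by rw [this X (Set.notMem_empty X), map_zero]

/-- The coordinate projection onto the elements supported on a family of sets. -/
noncomputable def proj (F : Type*) [Field F] {n : ℕ} (S : Set (Finset (Fin n))) :
    Grassmann F n →ₗ[F] Grassmann F n :=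
  open scoped Classical in (mon F n).constr F fun X => if X ∈ S then mon F n X else 0

open scoped Classical in
theorem coef_proj (S : Set (Finset (Fin n))) (X : Finset (Fin n)) (x : Grassmann F n) :
    coef X (proj F S x) = if X ∈ S then coef X x else 0 := by
  suffices h : coef X ∘ₗ proj F S = if X ∈ S then coef X else 0 by
    have := LinearMap.congr_fun h x
    rw [LinearMap.comp_apply] at this
    rw [this]
    split_ifs <;> rfl
  refine (mon F n).ext fun Y => ?_
  rw [LinearMap.comp_apply, proj, Basis.constr_basis]
  by_cases hXY : Y = X
  · subst hXY
    split_ifs <;> simp [coef_mon]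
  · split_ifs <;> simp [coef_mon, hXY]

theorem proj_mem (S : Set (Finset (Fin n))) (x : Grassmann F n) : proj F S x ∈ monSpan F S := by
  classical
  intro X hX
  rw [coef_proj, if_neg hX]

theorem proj_eq_self {x : Grassmann F n} (hx : x ∈ monSpan F S) : proj F S x = x := by
  classical
  refine ext_coef fun X => ?_
  rw [coef_proj]
  split_ifs with h
  · rfl
  · exact (hx X h).symm

theorem proj_mem_of_mem {x : Grassmann F n} (hx : x ∈ monSpan F T) :
    proj F S x ∈ monSpan F T := by
  classical
  intro X hX
  rw [coef_proj, hx X hX, ite_self]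

theorem proj_add_proj_compl (S : Set (Finset (Fin n))) (x : Grassmann F n) :
    proj F S x + proj F Sᶜ x = x := by
  classical
  refine ext_coef fun X => ?_
  rw [map_add, coef_proj, coef_proj]
  by_cases h : X ∈ S <;> simp [h]

theorem proj_compl_mem {U : Set (Finset (Fin n))} {x : Grassmann F n} (hx : x ∈ monSpan F T)
    (h : T ⊆ S ∪ U) : proj F Sᶜ x ∈ monSpan F U := fun X hX => by
  classical
  rw [coef_proj]
  split_ifs with hS
  · exact hx X fun hT => (h hT).elim hS hX
  · rfl

/-! ### Graded components and graded commutativity. -/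

theorem component_eq_monSpan (i : ℕ) : component F n i = monSpan F {X | X.card = i} := by
  have h := congrArg (Submodule.map (component F n i).subtype)
    ((Pi.basisFun F (Fin n)).exteriorPower i).span_eq
  rw [Submodule.map_subtype_top, Submodule.map_span] at h
  rw [← h, monSpan_eq_span]
  congr 1
  ext x
  constructor
  · rintro ⟨_, ⟨s, rfl⟩, rfl⟩
    exact ⟨s.1, s.2, ExteriorAlgebra.basis_eq_coe_basis (Pi.basisFun F (Fin n)) s⟩
  · rintro ⟨X, hX, rfl⟩
    exact ⟨_, ⟨⟨X, hX⟩, rfl⟩,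
      (ExteriorAlgebra.basis_eq_coe_basis (Pi.basisFun F (Fin n)) ⟨X, hX⟩).symm⟩

theorem iSup_component (P : ℕ → Prop) :
    ⨆ (i : ℕ) (_ : P i), component F n i = monSpan F {X | P X.card} := by
  simp_rw [component_eq_monSpan, ← monSpan_iSup]
  congr 1
  ext X
  simp

theorem evenPart_eq_monSpan : evenPart F n = monSpan F {X | Even X.card} :=
  iSup_component _

theorem highOddPart_eq_monSpan :
    highOddPart F n = monSpan F {X | Odd X.card ∧ n < 2 * X.card} :=
  iSup_component fun i => Odd i ∧ n < 2 * i

/-- The sum of the components of odd degree. -/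
noncomputable def oddPart (F : Type*) [Field F] (n : ℕ) : Submodule F (Grassmann F n) :=
  monSpan F {X | Odd X.card}

theorem one_mem_evenPart : (1 : Grassmann F n) ∈ evenPart F n := by
  have h : (1 : Grassmann F n) ∈ component F n 0 := Submodule.one_le.mp (le_of_eq (pow_zero _).symm)
  rw [evenPart_eq_monSpan]
  rw [component_eq_monSpan] at h
  exact monSpan_mono (fun X (hX : X.card = 0) => by simp [hX]) h

/-- A vector moves past a product of `j` vectors one factor at a time, each swap costing a sign. -/
theorem ι_mul_comm (v : Fin n → F) {j : ℕ} {y : Grassmann F n} (hy : y ∈ component F n j) :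
    ExteriorAlgebra.ι F v * y = (-1) ^ j * (y * ExteriorAlgebra.ι F v) := by
  induction hy using Submodule.pow_induction_on_left' with
  | algebraMap r => simp [Algebra.commutes]
  | add x y i _ _ hx hy => rw [mul_add, hx, hy, add_mul, mul_add]
  | mem_mul m hm i x hx ih =>
    obtain ⟨w, rfl⟩ := hm
    have h := eq_neg_of_add_eq_zero_left (ExteriorAlgebra.ι_add_mul_swap (R := F) v w)
    rw [← mul_assoc, h, neg_mul, mul_assoc, ih, pow_succ, ← mul_assoc,
      ((Commute.neg_one_right (ExteriorAlgebra.ι F w)).pow_right i).eq]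
    simp [mul_assoc]

theorem mul_comm_of_component {i j : ℕ} {x y : Grassmann F n} (hx : x ∈ component F n i)
    (hy : y ∈ component F n j) : x * y = (-1) ^ (i * j) * (y * x) := by
  induction hx using Submodule.pow_induction_on_left' with
  | algebraMap r => simp [Algebra.commutes]
  | add x z i _ _ hx hz => rw [add_mul, hx, hz, mul_add, mul_add]
  | mem_mul m hm i x hx ih =>
    obtain ⟨w, rfl⟩ := hm
    rw [mul_assoc, ih, ← mul_assoc, ((Commute.neg_one_right _).pow_right _).eq, mul_assoc,
      ← mul_assoc _ y x, ι_mul_comm w hy, Nat.succ_mul, pow_add]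
    simp only [mul_assoc]

theorem mon_mul_comm (X Y : Finset (Fin n)) :
    mon F n X * mon F n Y = (-1) ^ (X.card * Y.card) * (mon F n Y * mon F n X) :=
  mul_comm_of_component (by rw [component_eq_monSpan, mon_mem_monSpan]; rfl)
    (by rw [component_eq_monSpan, mon_mem_monSpan]; rfl)

theorem evenPart_mul_comm {x : Grassmann F n} (hx : x ∈ evenPart F n) (y : Grassmann F n) :
    x * y = y * x := by
  rw [evenPart_eq_monSpan, monSpan_eq_span] at hx
  induction hx using Submodule.span_induction with
  | zero => simp
  | add x z _ _ hx hz => rw [add_mul, mul_add, hx, hz]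
  | smul c x _ hx => rw [smul_mul_assoc, mul_smul_comm, hx]
  | mem x hx =>
    obtain ⟨X, hX, rfl⟩ := hx
    rw [← sum_coef y, Finset.mul_sum, Finset.sum_mul]
    refine Finset.sum_congr rfl fun Y _ => ?_
    rw [mul_smul_comm, smul_mul_assoc, mon_mul_comm, Even.neg_one_pow (Even.mul_right hX _),
      one_mul]

theorem oddPart_mul_comm {x y : Grassmann F n} (hx : x ∈ oddPart F n) (hy : y ∈ oddPart F n) :
    x * y = -(y * x) := by
  rw [oddPart, monSpan_eq_span] at hx hy
  induction hx using Submodule.span_induction with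
  | zero => simp
  | add x z _ _ hx hz => rw [add_mul, mul_add, hx, hz, neg_add]
  | smul c x _ hx => rw [smul_mul_assoc, mul_smul_comm, hx, smul_neg]
  | mem x hx =>
    obtain ⟨X, hX, rfl⟩ := hx
    induction hy using Submodule.span_induction with
    | zero => simp
    | add x z _ _ hx hz => rw [add_mul, mul_add, hx, hz, neg_add]
    | smul c x _ hx => rw [smul_mul_assoc, mul_smul_comm, hx, smul_neg]
    | mem x hx =>
      obtain ⟨Y, hY, rfl⟩ := hx
      rw [mon_mul_comm, Odd.neg_one_pow (Odd.mul hX hY), neg_one_mul]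

end Grassmann

/-! ### Commutative subalgebras and square zero odd subspaces. -/

namespace Grassmann

open Module

variable {F : Type*} [Field F] {n : ℕ}

theorem evenPart_mul_mem_evenPart {x y : Grassmann F n} (hx : x ∈ evenPart F n)
    (hy : y ∈ evenPart F n) : x * y ∈ evenPart F n := by
  rw [evenPart_eq_monSpan] at *
  refine mul_mem_monSpan hx hy fun X hX Y hY h => ?_
  rw [Set.mem_ofPred_eq, Finset.card_union_of_disjoint h]
  exact Even.add hX hY

theorem evenPart_mul_mem_oddPart {x y : Grassmann F n} (hx : x ∈ evenPart F n)
    (hy : y ∈ oddPart F n) : x * y ∈ oddPart F n := by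
  rw [evenPart_eq_monSpan] at *
  refine mul_mem_monSpan hx hy fun X hX Y hY h => ?_
  rw [Set.mem_ofPred_eq, Finset.card_union_of_disjoint h]
  exact Even.add_odd hX hY

theorem oddPart_mul_mem_evenPart {x y : Grassmann F n} (hx : x ∈ oddPart F n)
    (hy : y ∈ oddPart F n) : x * y ∈ evenPart F n := by
  rw [evenPart_eq_monSpan]
  refine mul_mem_monSpan hx hy fun X hX Y hY h => ?_
  rw [Set.mem_ofPred_eq, Finset.card_union_of_disjoint h]
  exact Odd.add_odd hX hY

theorem disjoint_even_odd : Disjoint {X : Finset (Fin n) | Even X.card} {X | Odd X.card} :=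
  Set.disjoint_left.mpr fun _ h h' => Nat.not_even_iff_odd.mpr h' h

theorem disjoint_evenPart_oddPart : Disjoint (evenPart F n) (oddPart F n) := by
  rw [evenPart_eq_monSpan]
  exact disjoint_monSpan disjoint_even_odd

/-- The projection onto the odd part. -/
noncomputable def oddProj (F : Type*) [Field F] (n : ℕ) : Grassmann F n →ₗ[F] Grassmann F n :=
  proj F {X | Odd X.card}

theorem oddProj_mem (x : Grassmann F n) : oddProj F n x ∈ oddPart F n := proj_mem _ _

theorem sub_oddProj_mem (x : Grassmann F n) : x - oddProj F n x ∈ evenPart F n := by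
  rw [evenPart_eq_monSpan]
  have h : x - oddProj F n x = proj F {X | Odd X.card}ᶜ x :=
    sub_eq_of_eq_add' (proj_add_proj_compl _ x).symm
  rw [h]
  exact monSpan_mono (fun X hX => Nat.not_odd_iff_even.mp hX) (proj_mem _ x)

theorem oddProj_of_mem {x : Grassmann F n} (hx : x ∈ oddPart F n) : oddProj F n x = x :=
  proj_eq_self hx

theorem mul_self_of_mem_oddPart (hF : ringChar F ≠ 2) {x : Grassmann F n}
    (hx : x ∈ oddPart F n) : x * x = 0 := by
  have h : (2 : F) • (x * x) = 0 := by
    rw [two_smul]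
    nth_rewrite 1 [oddPart_mul_comm hx hx]
    exact neg_add_cancel _
  exact (smul_eq_zero.mp h).resolve_left (Ring.two_ne_zero hF)

theorem mul_sub_mul_eq (x y : Grassmann F n) :
    x * y - y * x = (2 : F) • (oddProj F n x * oddProj F n y) := by
  have hx := evenPart_mul_comm (sub_oddProj_mem x) y
  have hy := evenPart_mul_comm (sub_oddProj_mem y) (oddProj F n x)
  have h := oddPart_mul_comm (oddProj_mem y) (oddProj_mem x)
  rw [sub_mul, mul_sub] at hx hy
  rw [two_smul]
  linear_combination (norm := abel) hx - hy - h

/-- The projection of a subalgebra to the odd part. -/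
noncomputable def oddImage (A : NonUnitalSubalgebra F (Grassmann F n)) :
    Submodule F (Grassmann F n) :=
  A.toSubmodule.map (oddProj F n)

theorem oddImage_le (A : NonUnitalSubalgebra F (Grassmann F n)) : oddImage A ≤ oddPart F n := by
  rintro _ ⟨x, -, rfl⟩
  exact oddProj_mem x

theorem isSquareZero_oddImage (hF : ringChar F ≠ 2) {A : NonUnitalSubalgebra F (Grassmann F n)}
    (hA : IsCommSubalgebra A) : IsSquareZero (oddImage A) := by
  rintro _ ⟨x, hx, rfl⟩ _ ⟨y, hy, rfl⟩
  have h := mul_sub_mul_eq x y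
  rw [hA x hx y hy, sub_self] at h
  exact (smul_eq_zero.mp h.symm).resolve_left (Ring.two_ne_zero hF)

theorem le_evenPart_sup_oddImage (A : NonUnitalSubalgebra F (Grassmann F n)) :
    A.toSubmodule ≤ evenPart F n ⊔ oddImage A := fun x hx => by
  rw [← sub_add_cancel x (oddProj F n x)]
  exact Submodule.add_mem_sup (sub_oddProj_mem x) ⟨x, hx, rfl⟩

/-- Since `D` is square zero, the product of `e + d` and `e' + d'` is `e * e' + (e * d' + e' * d)`,
which is symmetric and needs only stability to stay in the sum. -/
theorem exists_commSubalgebra_of_stable {D : Submodule F (Grassmann F n)}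
    (hsq : IsSquareZero D) (hE : ∀ e ∈ evenPart F n, ∀ d ∈ D, e * d ∈ D) :
    ∃ A : NonUnitalSubalgebra F (Grassmann F n),
      A.toSubmodule = evenPart F n ⊔ D ∧ IsCommSubalgebra A := by
  have key : ∀ x ∈ evenPart F n ⊔ D, ∀ y ∈ evenPart F n ⊔ D,
      x * y ∈ evenPart F n ⊔ D ∧ x * y = y * x := by
    intro x hx y hy
    obtain ⟨e, he, d, hd, rfl⟩ := Submodule.mem_sup.mp hx
    obtain ⟨e', he', d', hd', rfl⟩ := Submodule.mem_sup.mp hy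
    have h1 : (e + d) * (e' + d') = e * e' + (e * d' + e' * d) := by
      rw [add_mul, mul_add, mul_add, hsq d hd d' hd', evenPart_mul_comm he' d]
      abel
    have h2 : (e' + d') * (e + d) = e' * e + (e' * d + e * d') := by
      rw [add_mul, mul_add, mul_add, hsq d' hd' d hd, evenPart_mul_comm he d']
      abel
    refine ⟨?_, ?_⟩
    · rw [h1]
      exact Submodule.add_mem_sup (evenPart_mul_mem_evenPart he he')
        (add_mem (hE e he d' hd') (hE e' he' d hd))
    · rw [h1, h2, evenPart_mul_comm he e', add_comm (e * d')]
  exact ⟨{ (evenPart F n ⊔ D) with mul_mem' := fun {a b} ha hb => (key a ha b hb).1 }, rfl,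
    fun x hx y hy => (key x hx y hy).2⟩

/-- Replacing `C` by `evenPart F n * C` gains stability; it stays square zero because even factors
are central, and contains `C` because 1 is even. -/
theorem exists_commSubalgebra {C : Submodule F (Grassmann F n)}
    (hsq : IsSquareZero C) :
    ∃ A : NonUnitalSubalgebra F (Grassmann F n),
      evenPart F n ⊔ C ≤ A.toSubmodule ∧ IsCommSubalgebra A := by
  have hle : C ≤ evenPart F n * C := fun c hc => by
    simpa using Submodule.mul_mem_mul one_mem_evenPart hc
  obtain ⟨A, hA, hA'⟩ := exists_commSubalgebra_of_stable (D := evenPart F n * C)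
    (by
      intro x hx y hy
      induction hx using Submodule.mul_induction_on' with
      | add x _ y _ hx hy => rw [add_mul, hx, hy, add_zero]
      | mem_mul_mem e he c hc =>
        induction hy using Submodule.mul_induction_on' with
        | add x _ y _ hx hy => rw [mul_add, hx, hy, add_zero]
        | mem_mul_mem e' he' c' hc' =>
          rw [evenPart_mul_comm he', mul_assoc, ← mul_assoc c, hsq c hc c' hc', zero_mul,
            mul_zero]) (by
      intro e he d hd
      induction hd using Submodule.mul_induction_on' with
      | add x _ y _ hx hy =>
        rw [mul_add]
        exact add_mem hx hy
      | mem_mul_mem e' he' c' hc' =>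
        rw [← mul_assoc]
        exact Submodule.mul_mem_mul (evenPart_mul_mem_evenPart he he') hc')
  exact ⟨A, hA.symm ▸ sup_le_sup_left hle _, hA'⟩

theorem finrank_evenPart_sup {C : Submodule F (Grassmann F n)} (hC : C ≤ oddPart F n) :
    finrank F ↥(evenPart F n ⊔ C) = finrank F (evenPart F n) + finrank F C := by
  have h := Submodule.finrank_sup_add_finrank_inf_eq (evenPart F n) C
  rwa [(disjoint_evenPart_oddPart.mono_right hC).eq_bot, finrank_bot, add_zero] at h

theorem finrank_le_of_commSubalgebra (A : NonUnitalSubalgebra F (Grassmann F n)) :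
    finrank F A ≤ finrank F (evenPart F n) + finrank F (oddImage A) := by
  rw [← finrank_evenPart_sup (oddImage_le A)]
  exact Submodule.finrank_mono (le_evenPart_sup_oddImage A)

theorem IsMaximalComm.toSubmodule_eq (hF : ringChar F ≠ 2)
    {A : NonUnitalSubalgebra F (Grassmann F n)} (hA : IsMaximalComm A) :
    A.toSubmodule = evenPart F n ⊔ oddImage A := by
  obtain ⟨B, hB, hB'⟩ := exists_commSubalgebra (isSquareZero_oddImage hF hA.1)
  have hAB : A ≤ B := fun x hx => hB (le_evenPart_sup_oddImage A hx)
  have hBA : B ≤ A := hA.2 hB' hAB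
  exact le_antisymm (le_evenPart_sup_oddImage A) fun x hx => hBA (hB hx)

/-- An odd element squares to zero, so adjoining `d` keeps the odd image square zero, and maximality
absorbs it. -/
theorem IsMaximalComm.mem_of_mul_eq_zero (hF : ringChar F ≠ 2)
    {A : NonUnitalSubalgebra F (Grassmann F n)} (hA : IsMaximalComm A) {d : Grassmann F n}
    (hd : d ∈ oddPart F n) (h : ∀ c ∈ oddImage A, c * d = 0) : d ∈ A := by
  have hsq : IsSquareZero (oddImage A ⊔ Submodule.span F {d}) := by
    intro x hx y hy
    obtain ⟨c, hc, z, hz, rfl⟩ := Submodule.mem_sup.mp hx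
    obtain ⟨c', hc', z', hz', rfl⟩ := Submodule.mem_sup.mp hy
    obtain ⟨r, rfl⟩ := Submodule.mem_span_singleton.mp hz
    obtain ⟨s, rfl⟩ := Submodule.mem_span_singleton.mp hz'
    have hdc : d * c' = 0 := by
      rw [oddPart_mul_comm hd (oddImage_le A hc'), h c' hc', neg_zero]
    simp [add_mul, mul_add, isSquareZero_oddImage hF hA.1 c hc c' hc', h c hc, hdc,
      mul_self_of_mem_oddPart hF hd]
  obtain ⟨B, hB, hB'⟩ := exists_commSubalgebra hsq
  have hAB : A ≤ B := fun x hx => hB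
    ((sup_le_sup_left le_sup_left _ : evenPart F n ⊔ oddImage A ≤ _) (le_evenPart_sup_oddImage A hx))
  exact hA.2 hB' hAB (hB (Submodule.mem_sup_right (Submodule.mem_sup_right
    (Submodule.mem_span_singleton_self d))))

theorem exists_isMaximalComm_ge {A : NonUnitalSubalgebra F (Grassmann F n)}
    (hA : IsCommSubalgebra A) : ∃ B, A ≤ B ∧ IsMaximalComm B := by
  obtain ⟨W, ⟨B, ⟨hAB, hB⟩, rfl⟩, hmax⟩ := (wellFounded_gt (α := Submodule F (Grassmann F n))).has_min
    (NonUnitalSubalgebra.toSubmodule '' {B | A ≤ B ∧ IsCommSubalgebra B})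
    ⟨_, A, ⟨le_rfl, hA⟩, rfl⟩
  refine ⟨B, hAB, hB, fun B' hB' hle => ?_⟩
  by_contra hnot
  exact hmax _ ⟨B', ⟨hAB.trans hle, hB'⟩, rfl⟩ (lt_of_le_not_ge hle hnot)

theorem IsMaxDimComm.isMaximalComm {A : NonUnitalSubalgebra F (Grassmann F n)}
    (hA : IsMaxDimComm A) : IsMaximalComm A := by
  refine ⟨hA.1, fun B hB hle => ?_⟩
  have h : A.toSubmodule = B.toSubmodule :=
    Submodule.eq_of_le_of_finrank_le hle (hA.2 B hB)
  exact fun x hx => h.ge hx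

/-! ### Leading monomials and the reduction to intersecting systems. -/

/-- An injective weight on sets, additive on disjoint unions and refining the cardinality. -/
def weight (X : Finset (Fin n)) : ℕ := ∑ i ∈ X, (2 ^ n + 2 ^ (i : ℕ))

theorem sum_two_pow_lt (X : Finset (Fin n)) : ∑ i ∈ X, 2 ^ (i : ℕ) < 2 ^ n := by
  have := Nat.geomSum_lt (m := 2) (n := n) (s := X.map Fin.valEmbedding) le_rfl (by simp)
  simpa using this

theorem weight_eq (X : Finset (Fin n)) : weight X = 2 ^ n * X.card + ∑ i ∈ X, 2 ^ (i : ℕ) := by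
  simp [weight, Finset.sum_add_distrib, mul_comm]

/-- The binary tail of a weight is below `2 ^ n`, so it cannot offset a difference in cardinality.
-/
theorem card_le_of_weight_le {X Y : Finset (Fin n)} (h : weight X ≤ weight Y) :
    X.card ≤ Y.card := by
  by_contra! hlt
  rw [weight_eq, weight_eq] at h
  have h1 := sum_two_pow_lt Y
  have h2 : 2 ^ n * (Y.card + 1) ≤ 2 ^ n * X.card := Nat.mul_le_mul_left _ hlt
  rw [Nat.mul_succ] at h2
  omega

theorem weight_injective : Function.Injective (weight (n := n)) := by
  intro X Y h
  have hc : X.card = Y.card := (card_le_of_weight_le h.le).antisymm (card_le_of_weight_le h.ge)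
  rw [weight_eq, weight_eq, hc] at h
  have h' := Nat.add_left_cancel h
  refine Finset.map_injective Fin.valEmbedding (Finset.geomSum_injective (n := 2) le_rfl ?_)
  simpa using h'

theorem weight_union {X Y : Finset (Fin n)} (h : Disjoint X Y) :
    weight (X ∪ Y) = weight X + weight Y := Finset.sum_union h

/-- `X` is the monomial of least weight occurring in `x`. -/
def IsLead (x : Grassmann F n) (X : Finset (Fin n)) : Prop :=
  coef X x ≠ 0 ∧ ∀ Y, coef Y x ≠ 0 → weight X ≤ weight Y

theorem exists_isLead {x : Grassmann F n} (hx : x ≠ 0) : ∃ X, IsLead x X := by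
  classical
  have h : (Finset.univ.filter fun X => coef X x ≠ 0).Nonempty := by
    by_contra hne
    refine hx (ext_coef fun X => ?_)
    rw [map_zero]
    by_contra hX
    exact hne ⟨X, by simpa using hX⟩
  obtain ⟨X, hX, hmin⟩ := Finset.exists_min_image _ weight h
  exact ⟨X, by simpa using hX, fun Y hY => hmin Y (by simpa using hY)⟩

/-- For disjoint leads the monomial `X ∪ Y` would arise in `x * y` from the pair `(X, Y)` alone: any
other contributing pair has weights at least as large with the same sum, hence equal weights, hence
equal sets. -/
theorem IsLead.not_disjoint {x y : Grassmann F n} {X Y : Finset (Fin n)} (hX : IsLead x X)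
    (hY : IsLead y Y) (h : x * y = 0) : ¬ Disjoint X Y := by
  intro hd
  have hc : coef (X ∪ Y) (x * y) = coef X x * coef Y y * sgn F X Y := by
    have hz : ∀ X' Y', X' ∪ Y' = X ∪ Y → ¬ (X' = X ∧ Y' = Y) →
        coef X' x * coef Y' y * sgn F X' Y' = 0 := by
      intro X' Y' hu hne
      by_contra h0
      have hX' : coef X' x ≠ 0 := left_ne_zero_of_mul (left_ne_zero_of_mul h0)
      have hY' : coef Y' y ≠ 0 := right_ne_zero_of_mul (left_ne_zero_of_mul h0)
      have hd' : Disjoint X' Y' := by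
        by_contra hd'
        exact h0 (by rw [sgn_eq_zero hd', mul_zero])
      have hw := congrArg weight hu
      rw [weight_union hd, weight_union hd'] at hw
      have h1 := hX.2 X' hX'
      have h2 := hY.2 Y' hY'
      exact hne ⟨weight_injective (by omega), weight_injective (by omega)⟩
    rw [coef_mul, Finset.sum_eq_single X, Finset.sum_eq_single Y, if_pos rfl]
    · intro Y' _ hne
      split_ifs with hu
      · exact hz X Y' hu fun h => hne h.2
      · rfl
    · simp
    · intro X' _ hne
      refine Finset.sum_eq_zero fun Y' _ => ?_
      split_ifs with hu
      · exact hz X' Y' hu fun h => hne h.1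
      · rfl
    · simp
  rw [h, map_zero] at hc
  exact mul_ne_zero (mul_ne_zero hX.1 hY.1) (sgn_ne_zero hd) hc.symm

open scoped Classical in
/-- The family of the leading monomials of the elements of a subspace. -/
noncomputable def leadSet (C : Submodule F (Grassmann F n)) : Finset (Finset (Fin n)) :=
  Finset.univ.filter fun X => ∃ x ∈ C, IsLead x X

theorem mem_leadSet {C : Submodule F (Grassmann F n)} {X : Finset (Fin n)} :
    X ∈ leadSet C ↔ ∃ x ∈ C, IsLead x X := by
  simp [leadSet]

/-- A nonzero element has a nonzero coordinate at its own lead, so the coordinates in `leadSet C`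
determine elements of `C`. -/
theorem finrank_le_card_leadSet (C : Submodule F (Grassmann F n)) :
    finrank F C ≤ (leadSet C).card := by
  let f : C →ₗ[F] (leadSet C → F) := LinearMap.pi fun X => coef X.1 ∘ₗ C.subtype
  have hf : Function.Injective f := by
    rw [← LinearMap.ker_eq_bot, LinearMap.ker_eq_bot']
    intro x hx
    by_contra hne
    obtain ⟨X, hX⟩ := exists_isLead (x := (x : Grassmann F n)) (by simpa using hne)
    exact hX.1 (congrFun hx ⟨X, mem_leadSet.mpr ⟨x, x.2, hX⟩⟩)
  have := LinearMap.finrank_le_finrank_of_injective hf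
  simpa using this

theorem isOddIntersecting_leadSet {C : Submodule F (Grassmann F n)} (hC : C ≤ oddPart F n)
    (hsq : IsSquareZero C) : IsOddIntersecting (leadSet C) := by
  refine ⟨fun X hX Y hY => ?_, fun X hX => ?_⟩
  · obtain ⟨x, hx, hX⟩ := mem_leadSet.mp hX
    obtain ⟨y, hy, hY⟩ := mem_leadSet.mp hY
    exact Finset.not_disjoint_iff_nonempty_inter.mp (hX.not_disjoint hY (hsq x hx y hy))
  · obtain ⟨x, hx, hX⟩ := mem_leadSet.mp hX
    by_contra hodd
    exact hX.1 (hC hx X hodd)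

theorem isSquareZero_monSpan {S : Finset (Finset (Fin n))} (hS : IsOddIntersecting S) :
    IsSquareZero (monSpan F (S : Set (Finset (Fin n)))) := fun _ hx _ hy =>
  mul_eq_zero_of_monSpan hx hy fun X hX Y hY =>
    Finset.not_disjoint_iff_nonempty_inter.mpr (hS.1 X hX Y hY)

theorem isGreatest_commDims (hF : ringChar F ≠ 2) {m : ℕ}
    (hm : IsGreatest (oddIntersectingSizes n) m) :
    IsGreatest (commDims F n) (finrank F (evenPart F n) + m) := by
  have hle : ∀ A : NonUnitalSubalgebra F (Grassmann F n), IsCommSubalgebra A →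
      finrank F A ≤ finrank F (evenPart F n) + m := fun A hA =>
    (finrank_le_of_commSubalgebra A).trans (Nat.add_le_add_left ((finrank_le_card_leadSet _).trans
      (hm.2 ⟨_, isOddIntersecting_leadSet (oddImage_le A) (isSquareZero_oddImage hF hA), rfl⟩)) _)
  refine ⟨?_, ?_⟩
  · obtain ⟨S, hS, rfl⟩ := hm.1
    have hodd : monSpan F (S : Set (Finset (Fin n))) ≤ oddPart F n :=
      monSpan_mono fun X hX => hS.2 X hX
    obtain ⟨A, hA, hA'⟩ := exists_commSubalgebra (isSquareZero_monSpan (F := F) hS)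
    refine ⟨A, hA', (hle A hA').antisymm ?_⟩
    rw [← finrank_monSpan (F := F) S, ← finrank_evenPart_sup hodd]
    exact Submodule.finrank_mono hA
  · rintro _ ⟨A, hA, rfl⟩
    exact hle A hA

theorem isMaxDimComm_iff {m : ℕ} (hm : IsGreatest (commDims F n) m)
    {A : NonUnitalSubalgebra F (Grassmann F n)} :
    IsMaxDimComm A ↔ IsCommSubalgebra A ∧ finrank F A = m := by
  constructor
  · rintro ⟨hA, hmax⟩
    obtain ⟨B, hB, hBm⟩ := hm.1
    exact ⟨hA, (hm.2 ⟨A, hA, rfl⟩).antisymm (hBm ▸ hmax B hB)⟩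
  · rintro ⟨hA, rfl⟩
    exact ⟨hA, fun B hB => hm.2 ⟨B, hB, rfl⟩⟩

end Grassmann

/-! ### Extremal odd intersecting systems. -/

section OddIntersecting

open Finset

variable {n : ℕ}

/-- The sets of odd size larger than `n / 2`. -/
def highOddSets (n : ℕ) : Finset (Finset (Fin n)) :=
  univ.filter fun X => Odd X.card ∧ n < 2 * X.card

theorem mem_highOddSets {X : Finset (Fin n)} :
    X ∈ highOddSets n ↔ Odd X.card ∧ n < 2 * X.card := by
  simp [highOddSets]

/-- Each small set `X` is matched with the complements of `X` less one point: the full complement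
has even size, but these have odd size above `h`. Being disjoint from `X`, they are excluded from
`S`, and double counting shows that they outnumber the small sets. -/
theorem IsOddIntersecting.card_le_and {h : ℕ} {S : Finset (Finset (Fin (2 * h + 1)))}
    (hS : IsOddIntersecting S) :
    S.card ≤ (highOddSets (2 * h + 1)).card + (S.filter fun X => X.card = h).card ∧
      ((∃ X ∈ S, X.card < h) →
        S.card < (highOddSets (2 * h + 1)).card + (S.filter fun X => X.card = h).card) := by
  classical
  set L := S.filter fun X => X.card < h with hL
  set M := S.filter fun X => X.card = h with hM
  set T := S.filter fun X => h < X.card with hT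
  let r : Finset (Fin (2 * h + 1)) → Finset (Fin (2 * h + 1)) → Prop :=
    fun X Y => Disjoint X Y ∧ X.card + Y.card = 2 * h
  let N : Finset (Finset (Fin (2 * h + 1))) := univ.filter fun Y => ∃ X ∈ L, r X Y
  -- A set `X` with fewer than `h` points has `2 * h + 1 - X.card ≥ h + 2` neighbours, while a
  -- neighbour `Y` has at most `2 * h + 1 - Y.card = X.card + 1 ≤ h` of them.
  have hcount : L.card * (h + 2) ≤ N.card * h := by
    refine card_mul_le_card_mul r (fun X hX => ?_) (fun Y hY => ?_)
    · have hXh : X.card < h := (mem_filter.mp hX).2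
      have hsub : powersetCard (2 * h - X.card) Xᶜ ⊆ N.bipartiteAbove r X := by
        intro Y hY
        obtain ⟨hYX, hYc⟩ := mem_powersetCard.mp hY
        have hr : r X Y := ⟨disjoint_left.mpr fun a ha hb => mem_compl.mp (hYX hb) ha, by omega⟩
        exact mem_filter.mpr ⟨mem_filter.mpr ⟨mem_univ _, X, hX, hr⟩, hr⟩
      refine le_trans ?_ (card_le_card hsub)
      rw [card_powersetCard, card_compl, Fintype.card_fin,
        show 2 * h + 1 - X.card = 2 * h - X.card + 1 by omega, Nat.choose_succ_self_right]
      omega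
    · obtain ⟨X₀, hX₀, -, hc₀⟩ := (mem_filter.mp hY).2
      have hX₀h : X₀.card < h := (mem_filter.mp hX₀).2
      have hsub : L.bipartiteBelow r Y ⊆ powersetCard (2 * h - Y.card) Yᶜ := by
        intro X hX
        obtain ⟨-, hd, hc⟩ := mem_filter.mp hX
        exact mem_powersetCard.mpr
          ⟨fun a ha => mem_compl.mpr fun hb => disjoint_left.mp hd ha hb, by omega⟩
      refine (card_le_card hsub).trans ?_
      rw [card_powersetCard, card_compl, Fintype.card_fin,
        show 2 * h + 1 - Y.card = 2 * h - Y.card + 1 by omega, Nat.choose_succ_self_right]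
      omega
  have hdisj : Disjoint T N := by
    refine disjoint_left.mpr fun Y hY hYN => ?_
    obtain ⟨X, hX, hd, -⟩ := (mem_filter.mp hYN).2
    exact not_disjoint_iff_nonempty_inter.mpr
      (hS.1 X (mem_filter.mp hX).1 Y (mem_filter.mp hY).1) hd
  have hTN : T.card + N.card ≤ (highOddSets (2 * h + 1)).card := by
    rw [← card_union_of_disjoint hdisj]
    refine card_le_card (union_subset (fun Y hY => ?_) fun Y hY => ?_)
    · obtain ⟨hYS, hYh⟩ := mem_filter.mp hY
      exact mem_highOddSets.mpr ⟨hS.2 Y hYS, by omega⟩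
    · obtain ⟨X, hX, -, hc⟩ := (mem_filter.mp hY).2
      obtain ⟨hXS, hXh⟩ := mem_filter.mp hX
      have := hS.2 X hXS
      exact mem_highOddSets.mpr ⟨by grind, by omega⟩
  have hcard : S.card ≤ L.card + M.card + T.card := by
    refine (card_le_card fun X hX => ?_).trans
      ((card_union_le _ _).trans (Nat.add_le_add_right (card_union_le L M) T.card))
    rcases lt_trichotomy X.card h with h1 | h1 | h1
    · exact mem_union_left _ (mem_union_left _ (mem_filter.mpr ⟨hX, h1⟩))
    · exact mem_union_left _ (mem_union_right _ (mem_filter.mpr ⟨hX, h1⟩))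
    · exact mem_union_right _ (mem_filter.mpr ⟨hX, h1⟩)
  refine ⟨?_, ?_⟩
  · have : L.card ≤ N.card := by nlinarith
    omega
  · rintro ⟨X, hX, hXh⟩
    have hpos : 0 < L.card := card_pos.mpr ⟨X, mem_filter.mpr ⟨hX, hXh⟩⟩
    have : L.card < N.card := by nlinarith
    omega

/-- The maximal size of an odd intersecting system on `2 * h + 1` points. -/
def maxOddSize (h : ℕ) : ℕ :=
  (highOddSets (2 * h + 1)).card + if Odd h then (2 * h).choose (h - 1) else 0

/-- For odd `h` this is Erdős–Ko–Rado for `h`-sets in `2 * h + 1` points; for even `h` the layer has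
no odd sets. -/
theorem IsOddIntersecting.card_filter_middle_le {h : ℕ} {S : Finset (Finset (Fin (2 * h + 1)))}
    (hS : IsOddIntersecting S) :
    (S.filter fun X => X.card = h).card ≤ if Odd h then (2 * h).choose (h - 1) else 0 := by
  split_ifs with hh
  · refine erdos_ko_rado (n := 2 * h + 1) (fun X hX Y hY => ?_) (fun X hX => ?_) (by omega)
    · exact not_disjoint_iff_nonempty_inter.mpr
        (hS.1 X (mem_filter.mp hX).1 Y (mem_filter.mp hY).1)
    · exact (mem_filter.mp hX).2
  · rw [Nat.le_zero, card_eq_zero, filter_eq_empty_iff]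
    intro X hX hXh
    exact hh (hXh ▸ hS.2 X hX)

theorem IsOddIntersecting.card_le {h : ℕ} {S : Finset (Finset (Fin (2 * h + 1)))}
    (hS : IsOddIntersecting S) : S.card ≤ maxOddSize h :=
  hS.card_le_and.1.trans (Nat.add_le_add_left hS.card_filter_middle_le _)

theorem IsOddIntersecting.le_card_of_mem {h : ℕ} {S : Finset (Finset (Fin (2 * h + 1)))}
    (hS : IsOddIntersecting S) (hcard : maxOddSize h ≤ S.card) {X : Finset (Fin (2 * h + 1))}
    (hX : X ∈ S) : h ≤ X.card := by
  by_contra! hlt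
  have h1 := hS.card_le_and.2 ⟨X, hX, hlt⟩
  have h2 := hS.card_filter_middle_le
  rw [maxOddSize] at hcard
  omega

theorem card_filter_mem_and_card_eq (m j : ℕ) (a : Fin (m + 1)) :
    (univ.filter fun X : Finset (Fin (m + 1)) => X.card = j + 1 ∧ a ∈ X).card = m.choose j := by
  have h := card_filter_add_card_filter_not (s := powersetCard (j + 1) (univ : Finset (Fin (m + 1))))
    (fun X => a ∈ X)
  have h1 : (powersetCard (j + 1) (univ : Finset (Fin (m + 1)))).filter (fun X => a ∉ X) =
      powersetCard (j + 1) (univ.erase a) := by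
    ext X
    simp only [mem_filter, mem_powersetCard, subset_univ, true_and, subset_erase]
    tauto
  have h2 : (powersetCard (j + 1) (univ : Finset (Fin (m + 1)))).filter (fun X => a ∈ X) =
      univ.filter fun X : Finset (Fin (m + 1)) => X.card = j + 1 ∧ a ∈ X := by
    ext X
    simp
  rw [h1, h2, card_powersetCard, card_powersetCard, card_erase_of_mem (mem_univ _), card_univ,
    Fintype.card_fin, Nat.add_sub_cancel, Nat.choose_succ_succ'] at h
  omega

theorem isGreatest_maxOddSize (h : ℕ) :
    IsGreatest (oddIntersectingSizes (2 * h + 1)) (maxOddSize h) := by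
  refine ⟨?_, ?_⟩
  -- The extremal system adds to all large odd sets the star at 0 in the layer of size `h`, which is
  -- empty when `h` is even.
  · let M : Finset (Finset (Fin (2 * h + 1))) :=
      univ.filter fun X => Odd X.card ∧ X.card = h ∧ 0 ∈ X
    refine ⟨highOddSets (2 * h + 1) ∪ M, ⟨fun X hX Y hY => ?_, fun X hX => ?_⟩, ?_⟩
    · rw [← not_disjoint_iff_nonempty_inter]
      intro hd
      have hc := card_le_univ (X ∪ Y)
      rw [card_union_of_disjoint hd, Fintype.card_fin] at hc
      simp only [mem_union, mem_highOddSets, M, mem_filter, mem_univ, true_and] at hX hY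
      -- A set of size `h` disjoint from a larger one forces the larger to have size `h + 1`, and
      -- consecutive integers are not both odd.
      rcases hX with ⟨ho, hX⟩ | ⟨ho, hX, h0⟩ <;> rcases hY with ⟨ho', hY⟩ | ⟨ho', hY, h0'⟩
      · omega
      · grind
      · grind
      · exact disjoint_left.mp hd h0 h0'
    · simp only [mem_union, mem_highOddSets, M, mem_filter, mem_univ, true_and] at hX
      tauto
    · rw [card_union_of_disjoint, maxOddSize]
      · congr 1
        split_ifs with hh
        · obtain ⟨j, rfl⟩ := Nat.exists_eq_add_one_of_ne_zero hh.pos.ne'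
          rw [Nat.add_sub_cancel, ← card_filter_mem_and_card_eq _ j 0]
          congr 1
          ext X
          simp only [M, mem_filter, mem_univ, true_and]
          exact ⟨fun h => h.2, fun h => ⟨h.1.symm ▸ hh, h⟩⟩
        · rw [card_eq_zero, filter_eq_empty_iff]
          rintro X - ⟨ho, hXh, -⟩
          exact hh (hXh ▸ ho)
      · refine disjoint_left.mpr fun X hX hX' => ?_
        have h1 := (mem_highOddSets.mp hX).2
        have h2 := (mem_filter.mp hX').2.2.1
        omega
  · rintro _ ⟨S, hS, rfl⟩
    exact hS.card_le

theorem card_filter_card_mem (s : Finset ℕ) :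
    (univ.filter fun X : Finset (Fin n) => X.card ∈ s).card = ∑ j ∈ s, n.choose j := by
  rw [card_eq_sum_card_fiberwise (f := card) (t := s) fun X hX => by simpa using hX]
  refine sum_congr rfl fun j hj => ?_
  rw [filter_filter, ← Fintype.card_fin n, ← card_univ, ← card_powersetCard, card_univ,
    Fintype.card_fin]
  congr 1
  ext X
  simp only [mem_filter, mem_univ, true_and, mem_powersetCard, subset_univ]
  exact ⟨fun h => h.2, fun h => ⟨h ▸ hj, h⟩⟩

theorem card_highOddSets {a b c : ℕ} (h : ∀ j, j ≤ n →
      ((Odd j ∧ n < 2 * j) ↔ ∃ l ∈ Icc a b, 2 * l + c = j)) :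
    (highOddSets n).card = ∑ l ∈ Icc a b, n.choose (2 * l + c) := by
  have hs : highOddSets n =
      univ.filter fun X : Finset (Fin n) => X.card ∈ (Icc a b).image fun l => 2 * l + c := by
    ext X
    have hX : X.card ≤ n := by simpa using card_le_univ X
    rw [mem_highOddSets, h _ hX]
    simp
  rw [hs, card_filter_card_mem, sum_image fun x _ y _ hxy => ?_]
  have : 2 * x + c = 2 * y + c := hxy
  omega

theorem maxOddSize_two_mul (k : ℕ) :
    maxOddSize (2 * k) = ∑ l ∈ Icc k (2 * k), (4 * k + 1).choose (2 * l + 1) := by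
  rw [maxOddSize, if_neg (by simp), add_zero, card_highOddSets (a := k) (b := 2 * k) (c := 1)]
  · rw [show 2 * (2 * k) + 1 = 4 * k + 1 by ring]
  · intro j hj
    simp only [mem_Icc]
    constructor
    · rintro ⟨⟨l, rfl⟩, h⟩
      exact ⟨l, by omega, rfl⟩
    · rintro ⟨l, h, rfl⟩
      exact ⟨⟨l, rfl⟩, by omega⟩

theorem maxOddSize_two_mul_add_one (k : ℕ) :
    maxOddSize (2 * k + 1) =
      (4 * k + 2).choose (2 * k) + ∑ l ∈ Icc k (2 * k), (4 * k + 3).choose (2 * l + 3) := by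
  rw [maxOddSize, if_pos (by simp), card_highOddSets (a := k) (b := 2 * k) (c := 3), add_comm]
  · rw [show 2 * (2 * k + 1) + 1 = 4 * k + 3 by ring, show 2 * (2 * k + 1) = 4 * k + 2 by ring,
      Nat.add_sub_cancel]
  · intro j hj
    simp only [mem_Icc]
    constructor
    · rintro ⟨⟨l, rfl⟩, h⟩
      -- The size bound gives `l ≥ k + 1`, so the truncated subtraction is exact.
      exact ⟨l - 1, by omega, by omega⟩
    · rintro ⟨l, h, rfl⟩
      exact ⟨⟨l + 1, by ring⟩, by omega⟩

theorem card_filter_even (hn : n ≠ 0) :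
    (univ.filter fun X : Finset (Fin n) => Even X.card).card = 2 ^ (n - 1) := by
  obtain ⟨m, rfl⟩ := Nat.exists_eq_add_one_of_ne_zero hn
  have h1 : (univ.filter fun X : Finset (Fin (m + 1)) => Even X.card).card =
      (univ.filter fun X : Finset (Fin (m + 1)) => ¬ Even X.card).card := by
    -- Toggling the point 0 is an involution that changes parity.
    let t : Finset (Fin (m + 1)) → Finset (Fin (m + 1)) :=
      fun X => if 0 ∈ X then X.erase 0 else insert 0 X
    have ht : ∀ X, t (t X) = X := fun X => by
      by_cases h : 0 ∈ X <;> simp [t, h, insert_erase]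
    have hc : ∀ X, Even (t X).card ↔ ¬ Even X.card := fun X => by
      by_cases h : 0 ∈ X
      · simp only [t, h, if_true]
        rw [← card_erase_add_one h, Nat.even_add_one, not_not]
      · simp only [t, h, if_false]
        rw [card_insert_of_notMem h, Nat.even_add_one]
    refine card_nbij' t t (fun X hX => ?_) (fun X hX => ?_) (fun X _ => ht X) (fun X _ => ht X)
    · exact mem_filter.mpr ⟨mem_univ _, fun h => (hc X).mp h (mem_filter.mp hX).2⟩
    · exact mem_filter.mpr ⟨mem_univ _, (hc X).mpr (mem_filter.mp hX).2⟩
  have h2 := card_filter_add_card_filter_not (s := (univ : Finset (Finset (Fin (m + 1)))))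
    (fun X => Even X.card)
  rw [← h1, card_univ, Fintype.card_finset, Fintype.card_fin, pow_succ] at h2
  rw [Nat.add_sub_cancel]
  omega

theorem card_filter_odd (hn : n ≠ 0) :
    (univ.filter fun X : Finset (Fin n) => Odd X.card).card = 2 ^ (n - 1) := by
  obtain ⟨m, rfl⟩ := Nat.exists_eq_add_one_of_ne_zero hn
  have h2 := card_filter_add_card_filter_not (s := (univ : Finset (Finset (Fin (m + 1)))))
    (fun X => Even X.card)
  have h3 : (univ.filter fun X : Finset (Fin (m + 1)) => Odd X.card).card =
      (univ.filter fun X : Finset (Fin (m + 1)) => ¬ Even X.card).card :=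
    congrArg card (by ext X; simp)
  rw [card_filter_even hn, card_univ, Fintype.card_finset, Fintype.card_fin, pow_succ] at h2
  rw [Nat.add_sub_cancel] at h2 ⊢
  omega

theorem odd_card_compl (hn : Even n) {X : Finset (Fin n)} : Odd Xᶜ.card ↔ Odd X.card := by
  have hX : X.card ≤ n := by simpa using card_le_univ X
  have h := Nat.even_sub hX
  rw [card_compl, Fintype.card_fin, ← Nat.not_even_iff_odd, ← Nat.not_even_iff_odd]
  tauto

/-- For even `n` complementation preserves odd size. An intersecting system takes at most one set of
each complementary pair, and the star at 0 takes exactly one. -/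
theorem isGreatest_oddIntersectingSizes_even (hn : Even n) (h2 : 2 ≤ n) :
    IsGreatest (oddIntersectingSizes n) (2 ^ (n - 2)) := by
  obtain ⟨m, rfl⟩ := Nat.exists_eq_add_of_le' h2
  have hodd := card_filter_odd (n := m + 2) (by omega)
  rw [show m + 2 - 1 = m + 1 by omega, pow_succ] at hodd
  rw [Nat.add_sub_cancel]
  refine ⟨?_, ?_⟩
  · refine ⟨univ.filter fun X => Odd X.card ∧ 0 ∈ X, ⟨fun X hX Y hY => ?_, fun X hX => ?_⟩, ?_⟩
    · exact ⟨0, mem_inter.mpr ⟨(mem_filter.mp hX).2.2, (mem_filter.mp hY).2.2⟩⟩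
    · exact (mem_filter.mp hX).2.1
    · have h := card_filter_add_card_filter_not
        (s := univ.filter fun X : Finset (Fin (m + 2)) => Odd X.card) (fun X => 0 ∈ X)
      rw [filter_filter, filter_filter, hodd] at h
      have h' : (univ.filter fun X : Finset (Fin (m + 2)) => Odd X.card ∧ 0 ∈ X).card =
          (univ.filter fun X : Finset (Fin (m + 2)) => Odd X.card ∧ 0 ∉ X).card := by
        refine card_nbij' compl compl (fun X hX => ?_) (fun X hX => ?_)
          (fun X _ => compl_compl X) (fun X _ => compl_compl X)
        · simpa [odd_card_compl hn] using hX
        · simpa [odd_card_compl hn] using hX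
      omega
  · rintro _ ⟨S, hS, rfl⟩
    have hd : Disjoint S (S.image compl) := by
      refine disjoint_left.mpr fun X hX hX' => ?_
      obtain ⟨Y, hY, rfl⟩ := mem_image.mp hX'
      exact not_disjoint_iff_nonempty_inter.mpr (hS.1 _ hX _ hY) disjoint_compl_left
    have hc : (S ∪ S.image compl).card ≤
        (univ.filter fun X : Finset (Fin (m + 2)) => Odd X.card).card := by
      refine card_le_card fun X hX => mem_filter.mpr ⟨mem_univ _, ?_⟩
      rcases mem_union.mp hX with hX | hX
      · exact hS.2 X hX
      · obtain ⟨Y, hY, rfl⟩ := mem_image.mp hX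
        exact (odd_card_compl hn).mpr (hS.2 Y hY)
    rw [card_union_of_disjoint hd, card_image_of_injective _ compl_injective, hodd] at hc
    omega

theorem exists_isGreatest_oddIntersectingSizes (n : ℕ) :
    ∃ m, IsGreatest (oddIntersectingSizes n) m := by
  have hfin : (oddIntersectingSizes n).Finite :=
    (Set.finite_range (fun S : Finset (Finset (Fin n)) => S.card)).subset
      fun _ ⟨S, _, h⟩ => ⟨S, h⟩
  exact ⟨_, hfin.isCompact.isGreatest_sSup ⟨0, ∅, ⟨by simp, by simp⟩, rfl⟩⟩

end OddIntersecting

namespace Grassmann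

open Module

variable {F : Type*} [Field F] {n : ℕ}

theorem finrank_monSpan_setOf (p : Finset (Fin n) → Prop) [DecidablePred p] :
    finrank F (monSpan F {X | p X}) = (Finset.univ.filter p).card := by
  have hs : {X | p X} = (Finset.univ.filter p : Set (Finset (Fin n))) := by
    ext X
    simp
  rw [hs, finrank_monSpan]

theorem finrank_evenPart (hn : n ≠ 0) : finrank F (evenPart F n) = 2 ^ (n - 1) := by
  rw [evenPart_eq_monSpan, finrank_monSpan_setOf, card_filter_even hn]

theorem finrank_grassmann : finrank F (Grassmann F n) = 2 ^ n := by
  rw [finrank_eq_card_basis (mon F n), Fintype.card_finset, Fintype.card_fin]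

theorem coef_mon_mul {X Z : Finset (Fin n)} (h : Disjoint X Z) (y : Grassmann F n) :
    coef (X ∪ Z) (mon F n X * y) = sgn F X Z * coef Z y := by
  rw [coef_mul, Finset.sum_eq_single X, Finset.sum_eq_single Z]
  · simp [coef_mon, mul_comm]
  · intro Y _ hY
    split_ifs with hu
    · rw [sgn_eq_zero, mul_zero]
      intro hd
      refine hY ?_
      rw [← Finset.union_sdiff_cancel_left hd, hu, Finset.union_sdiff_cancel_left h]
    · rfl
  · simp
  · intro Y _ hY
    refine Finset.sum_eq_zero fun Z _ => ?_
    simp [coef_mon, hY.symm]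
  · simp

theorem coef_eq_zero_of_mon_mul {X Z : Finset (Fin n)} (h : Disjoint X Z) {y : Grassmann F n}
    (hy : mon F n X * y = 0) : coef Z y = 0 := by
  have := coef_mon_mul h y
  rw [hy, map_zero] at this
  exact (mul_eq_zero.mp this.symm).resolve_left (sgn_ne_zero h)

theorem exists_proj_eq_algebraMap (x : Grassmann F n) :
    ∃ r : F, proj F {X | X.card = 0} x = algebraMap F (Grassmann F n) r := by
  have h := proj_mem {X : Finset (Fin n) | X.card = 0} x
  rw [← component_eq_monSpan] at h
  obtain ⟨r, hr⟩ := Submodule.mem_one.mp (show _ ∈ (1 : Submodule F (Grassmann F n)) from h)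
  exact ⟨r, hr.symm⟩

/-! ### The top-coefficient form and the common dimension for even `n`. -/

section Even

/-- The form sending two elements to the top coefficient of their product. -/
noncomputable def topForm (F : Type*) [Field F] (n : ℕ) : LinearMap.BilinForm F (Grassmann F n) :=
  (LinearMap.mul F (Grassmann F n)).compr₂ (coef Finset.univ)

theorem topForm_apply (x y : Grassmann F n) : topForm F n x y = coef Finset.univ (x * y) := rfl

theorem mem_orthogonal_topForm {C : Submodule F (Grassmann F n)} {x : Grassmann F n} :
    x ∈ (topForm F n).orthogonal C ↔ ∀ c ∈ C, coef Finset.univ (c * x) = 0 := by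
  rw [LinearMap.BilinForm.mem_orthogonal_iff]
  exact forall₂_congr fun c _ => by rw [topForm_apply]

theorem ker_topForm : LinearMap.ker (topForm F n) = ⊥ := by
  refine LinearMap.ker_eq_bot'.mpr fun x hx => ext_coef fun X => ?_
  have h := LinearMap.congr_fun hx (mon F n Xᶜ)
  rw [topForm_apply, coef_mul_mon_compl, LinearMap.zero_apply] at h
  rw [map_zero]
  exact (mul_eq_zero.mp h).resolve_right (sgn_ne_zero disjoint_compl_right)

theorem coef_univ_of_mem_oddPart (hn : Even n) {x : Grassmann F n} (hx : x ∈ oddPart F n) :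
    coef Finset.univ x = 0 := by
  refine hx _ ?_
  simpa using hn

/-- For even `n` complements of even sets are even, so the form is nondegenerate already on the even
part. -/
theorem eq_zero_of_evenPart_mul (hn : Even n) {x : Grassmann F n} (hx : x ∈ evenPart F n)
    (h : ∀ e ∈ evenPart F n, coef Finset.univ (e * x) = 0) : x = 0 := by
  rw [evenPart_eq_monSpan] at hx
  refine ext_coef fun X => ?_
  rw [map_zero]
  by_cases hX : Even X.card
  · have hXc : mon F n Xᶜ ∈ evenPart F n := by
      rw [evenPart_eq_monSpan, mon_mem_monSpan]
      refine Nat.not_odd_iff_even.mp fun ho => Nat.not_even_iff_odd.mpr ?_ hX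
      exact (odd_card_compl hn).mp ho
    have h' := h _ hXc
    rw [evenPart_mul_comm hXc, coef_mul_mon_compl] at h'
    exact (mul_eq_zero.mp h').resolve_right (sgn_ne_zero disjoint_compl_right)
  · exact hx X hX

theorem IsMaximalComm.evenPart_le (hF : ringChar F ≠ 2)
    {A : NonUnitalSubalgebra F (Grassmann F n)} (hA : IsMaximalComm A) :
    evenPart F n ≤ A.toSubmodule :=
  le_sup_left.trans (hA.toSubmodule_eq hF).ge

theorem IsMaximalComm.oddImage_le_self (hF : ringChar F ≠ 2)
    {A : NonUnitalSubalgebra F (Grassmann F n)} (hA : IsMaximalComm A) :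
    oddImage A ≤ A.toSubmodule :=
  le_sup_right.trans (hA.toSubmodule_eq hF).ge

theorem mem_oddImage {A : NonUnitalSubalgebra F (Grassmann F n)} {x : Grassmann F n}
    (hx : x ∈ A) (hodd : x ∈ oddPart F n) : x ∈ oddImage A :=
  ⟨x, hx, oddProj_of_mem hodd⟩

/-- Even times odd has no top coefficient when `n` is even, and odd elements of `A` multiply to
zero. Conversely, the odd image is stable under even multipliers, so if `x` is orthogonal to it,
each product of an odd `c` in it with the odd part of `x` is an even element orthogonal to the even
part, hence zero; maximality then puts the odd part of `x` in `A`. -/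
theorem IsMaximalComm.orthogonal_oddImage (hF : ringChar F ≠ 2) (hn : Even n)
    {A : NonUnitalSubalgebra F (Grassmann F n)} (hA : IsMaximalComm A) :
    (topForm F n).orthogonal (oddImage A) = A.toSubmodule := by
  refine le_antisymm (fun x hx => ?_) ?_
  · rw [mem_orthogonal_topForm] at hx
    have hd : oddProj F n x ∈ A := by
      refine hA.mem_of_mul_eq_zero hF (oddProj_mem x) fun c hc => ?_
      have hc' := oddImage_le A hc
      refine eq_zero_of_evenPart_mul hn (oddPart_mul_mem_evenPart hc' (oddProj_mem x))
        fun e he => ?_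
      have hec : e * c ∈ oddImage A := mem_oddImage
        (A.mul_mem (hA.evenPart_le hF he) (hA.oddImage_le_self hF hc))
        (evenPart_mul_mem_oddPart he hc')
      have h1 : coef Finset.univ (e * c * x) = 0 := hx (e * c) hec
      have h2 : e * c * x = (x - oddProj F n x) * (e * c) + e * (c * oddProj F n x) := by
        rw [evenPart_mul_comm (sub_oddProj_mem x), mul_sub, mul_assoc e c (oddProj F n x)]
        abel
      rwa [h2, map_add, coef_univ_of_mem_oddPart hn (evenPart_mul_mem_oddPart
        (sub_oddProj_mem x) (oddImage_le A hec)), zero_add] at h1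
    rw [← sub_add_cancel x (oddProj F n x)]
    exact add_mem (hA.evenPart_le hF (sub_oddProj_mem x)) hd
  · rw [hA.toSubmodule_eq hF]
    refine sup_le (fun e he => ?_) fun d hd => ?_
    · rw [mem_orthogonal_topForm]
      intro c hc
      rw [← evenPart_mul_comm he]
      exact coef_univ_of_mem_oddPart hn (evenPart_mul_mem_oddPart he (oddImage_le A hc))
    · rw [mem_orthogonal_topForm]
      intro c hc
      rw [isSquareZero_oddImage hF hA.1 c hc d hd, map_zero]

/-- With `C` the odd image, nondegeneracy gives `dim C + dim A = 2 ^ n`, while `dim A` is `dim C`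
plus the dimension of the even part. -/
theorem IsMaximalComm.two_mul_finrank (hF : ringChar F ≠ 2) (hn : Even n)
    {A : NonUnitalSubalgebra F (Grassmann F n)} (hA : IsMaximalComm A) :
    2 * finrank F A = finrank F (evenPart F n) + 2 ^ n := by
  have h := LinearMap.BilinForm.finrank_add_finrank_orthogonal' (B := topForm F n) (oddImage A)
  rw [hA.orthogonal_oddImage hF hn, ker_topForm, inf_bot_eq, finrank_bot, add_zero,
    finrank_grassmann] at h
  have h' := finrank_evenPart_sup (oddImage_le A)
  rw [← hA.toSubmodule_eq hF] at h'
  change finrank F A.toSubmodule = _ at h'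
  change 2 * finrank F A.toSubmodule = _
  omega

end Even

/-! ### Classification of maximal dimensional subalgebras for odd `n`. -/

section Odd

variable {h : ℕ}

/-- Disjoint supports would have total size at least `h + (h + 1) = n`; the sum of two odd sizes is
even, so it would exceed `n`. -/
theorem mul_eq_zero_of_highOdd (hn : n = 2 * h + 1) {x y : Grassmann F n}
    (hx : x ∈ monSpan F {X | Odd X.card ∧ h ≤ X.card}) (hy : y ∈ highOddPart F n) :
    x * y = 0 := by
  rw [highOddPart_eq_monSpan] at hy
  refine mul_eq_zero_of_monSpan hx hy fun X hX Y hY hd => ?_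
  have hc := Finset.card_le_univ (X ∪ Y)
  rw [Finset.card_union_of_disjoint hd, Fintype.card_fin] at hc
  obtain ⟨⟨a, ha⟩, hX⟩ := hX
  obtain ⟨⟨b, hb⟩, hY⟩ := hY
  omega

theorem highOddPart_le (hn : n = 2 * h + 1) :
    highOddPart F n ≤ monSpan F {X | Odd X.card ∧ h ≤ X.card} := by
  rw [highOddPart_eq_monSpan]
  refine monSpan_mono fun X hX => ⟨hX.1, ?_⟩
  have := hX.2
  omega

theorem finrank_highOddPart : finrank F (highOddPart F n) = (highOddSets n).card := by
  rw [highOddPart_eq_monSpan, finrank_monSpan_setOf]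
  rfl

theorem le_odd_ge {D : Submodule F (Grassmann F n)} (hD : D ≤ component F n h)
    (hodd : D ≤ oddPart F n) : D ≤ monSpan F {X | Odd X.card ∧ h ≤ X.card} := fun x hx => by
  have h1 := hD hx
  rw [component_eq_monSpan] at h1
  exact monSpan_mono (T := {X | Odd X.card ∧ h ≤ X.card})
    (fun X hX => ⟨hX.1, (show X.card = h from hX.2).ge⟩) (mem_monSpan_inter (hodd hx) h1)

/-- The scalar part of `e` preserves the space, and the rest raises degree by at least 2, carrying
degree `h` or more beyond `n / 2`. -/
theorem evenPart_mul_mem_sup_highOddPart (hn : n = 2 * h + 1) {D : Submodule F (Grassmann F n)}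
    (hD : D ≤ monSpan F {X | Odd X.card ∧ h ≤ X.card}) {e x : Grassmann F n}
    (he : e ∈ evenPart F n) (hx : x ∈ D ⊔ highOddPart F n) : e * x ∈ D ⊔ highOddPart F n := by
  obtain ⟨r, hr⟩ := exists_proj_eq_algebraMap e
  have hx' := (sup_le hD (highOddPart_le hn)) hx
  rw [evenPart_eq_monSpan] at he
  have he' : proj F {X | X.card = 0}ᶜ e ∈ monSpan F {X | Even X.card ∧ X.card ≠ 0} :=
    mem_monSpan_inter (proj_mem_of_mem he) (proj_mem _ _)
  rw [← proj_add_proj_compl {X | X.card = 0} e, hr, add_mul, ← Algebra.smul_def]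
  refine add_mem (Submodule.smul_mem _ _ hx) (Submodule.mem_sup_right ?_)
  rw [highOddPart_eq_monSpan]
  refine mul_mem_monSpan he' hx' fun X hX Y hY hd => ?_
  obtain ⟨⟨a, ha⟩, hX⟩ := hX
  obtain ⟨⟨b, hb⟩, hY⟩ := hY
  rw [Set.mem_ofPred_eq, Finset.card_union_of_disjoint hd]
  exact ⟨⟨a + b, by omega⟩, by omega⟩

theorem exists_commSubalgebra_highOddPart (hn : n = 2 * h + 1)
    {D : Submodule F (Grassmann F n)} (hD : D ≤ component F n h) (hodd : D ≤ oddPart F n)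
    (hsq : IsSquareZero D) :
    ∃ A : NonUnitalSubalgebra F (Grassmann F n),
      A.toSubmodule = evenPart F n ⊔ (D ⊔ highOddPart F n) ∧ IsCommSubalgebra A ∧
      finrank F A = finrank F (evenPart F n) + (finrank F D + (highOddSets n).card) := by
  have hle := le_odd_ge hD hodd
  have hH := highOddPart_le (F := F) hn
  obtain ⟨A, hA, hA'⟩ := exists_commSubalgebra_of_stable (D := D ⊔ highOddPart F n) (by
      intro x hx y hy
      have hy' := sup_le hle hH hy
      obtain ⟨d, hd, u, hu, rfl⟩ := Submodule.mem_sup.mp hx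
      obtain ⟨d', hd', u', hu', rfl⟩ := Submodule.mem_sup.mp hy
      have hodd' : monSpan F {X : Finset (Fin n) | Odd X.card ∧ h ≤ X.card} ≤ oddPart F n :=
        monSpan_mono fun X hX => hX.1
      rw [add_mul, mul_add, hsq d hd d' hd', mul_eq_zero_of_highOdd hn (hle hd) hu',
        oddPart_mul_comm (hodd' (hH hu)) (hodd' hy'), mul_eq_zero_of_highOdd hn hy' hu]
      simp) (fun e he x hx => evenPart_mul_mem_sup_highOddPart hn hle he hx)
  refine ⟨A, hA, hA', ?_⟩
  have hdisj : D ⊓ highOddPart F n = ⊥ := by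
    refine (Disjoint.mono_left hD ?_).eq_bot
    rw [component_eq_monSpan, highOddPart_eq_monSpan]
    refine disjoint_monSpan (Set.disjoint_left.mpr fun X (hX : X.card = h) hX' => ?_)
    have := hX'.2
    omega
  have h1 := Submodule.finrank_sup_add_finrank_inf_eq D (highOddPart F n)
  rw [hdisj, finrank_bot, add_zero, finrank_highOddPart] at h1
  have h2 : finrank F ↥(evenPart F n ⊔ (D ⊔ highOddPart F n)) = _ :=
    finrank_evenPart_sup (sup_le hodd ((highOddPart_le hn).trans (monSpan_mono fun X hX => hX.1)))
  rw [← hA, h1] at h2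
  exact h2

theorem isGreatest_commDims_odd (hF : ringChar F ≠ 2) (hn : n = 2 * h + 1) :
    IsGreatest (commDims F n) (finrank F (evenPart F n) + maxOddSize h) := by
  subst hn
  exact isGreatest_commDims hF (isGreatest_maxOddSize h)

/-- Maximal dimension makes the system of leads extremal, so every lead has size at least `h`. A
lead has least weight, hence least degree, so the bound passes to all monomials of the element. -/
theorem oddImage_le_of_isMaxDimComm (hF : ringChar F ≠ 2) (hn : n = 2 * h + 1)
    {A : NonUnitalSubalgebra F (Grassmann F n)} (hA : IsMaxDimComm A) :
    oddImage A ≤ monSpan F {X | Odd X.card ∧ h ≤ X.card} := by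
  subst hn
  have h1 := ((isMaxDimComm_iff (isGreatest_commDims_odd hF rfl)).mp hA).2
  have h2 := finrank_le_of_commSubalgebra A
  have h3 := finrank_le_card_leadSet (oddImage A)
  have hlead := isOddIntersecting_leadSet (oddImage_le A) (isSquareZero_oddImage hF hA.1)
  intro x hx X hX
  by_contra h0
  obtain ⟨Y, hY⟩ := exists_isLead (x := x) (by rintro rfl; exact h0 (map_zero _))
  refine hX ⟨?_, ?_⟩
  · by_contra hodd
    exact h0 (oddImage_le A hx X hodd)
  · exact (hlead.le_card_of_mem (by omega) (mem_leadSet.mpr ⟨x, hx, hY⟩)).trans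
      (card_le_of_weight_le (hY.2 X h0))

theorem isMaxDimComm_iff_odd (hF : ringChar F ≠ 2) (hn : n = 2 * h + 1)
    {A : NonUnitalSubalgebra F (Grassmann F n)} :
    IsMaxDimComm A ↔ ∃ D : Submodule F (Grassmann F n),
      D ≤ component F n h ∧ IsSquareZero D ∧
      finrank F D = (if Odd h then (2 * h).choose (h - 1) else 0) ∧
      A.toSubmodule = evenPart F n ⊔ D ⊔ highOddPart F n := by
  have hmax : maxOddSize h =
      (highOddSets n).card + if Odd h then (2 * h).choose (h - 1) else 0 := by
    subst hn
    rfl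
  constructor
  · intro hA
    have hC := oddImage_le_of_isMaxDimComm hF hn hA
    have hsplit : ∀ x ∈ oddImage A, proj F {X | X.card = h}ᶜ x ∈ highOddPart F n := by
      intro x hx
      rw [highOddPart_eq_monSpan]
      refine proj_compl_mem (hC hx) fun X hX => ?_
      rcases hX.2.eq_or_lt with h1 | h1
      · exact Or.inl h1.symm
      · exact Or.inr ⟨hX.1, by omega⟩
    -- `D` is the degree `h` layer of the odd image. It inherits the square zero property because
    -- the remaining high part annihilates all odd degrees from `h` up.
    set D := (oddImage A).map (proj F {X | X.card = h}) with hD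
    have hDh : D ≤ component F n h := by
      rintro _ ⟨x, -, rfl⟩
      rw [component_eq_monSpan]
      exact proj_mem _ _
    have hDodd : D ≤ oddPart F n := by
      rintro _ ⟨x, hx, rfl⟩
      exact proj_mem_of_mem (oddImage_le A hx)
    have hle := le_odd_ge hDh hDodd
    have hsq : IsSquareZero D := by
      rintro _ ⟨x, hx, rfl⟩ _ ⟨y, hy, rfl⟩
      have hxy := isSquareZero_oddImage hF hA.1 x hx y hy
      have hu := hsplit x hx
      have hu' := highOddPart_le hn hu
      rw [← proj_add_proj_compl {X | X.card = h} x, add_mul,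
        oddPart_mul_comm (monSpan_mono (fun X hX => hX.1) hu') (oddImage_le A hy),
        mul_eq_zero_of_highOdd hn (hC hy) hu, neg_zero, add_zero] at hxy
      rwa [← proj_add_proj_compl {X | X.card = h} y, mul_add,
        mul_eq_zero_of_highOdd hn (hle ⟨x, hx, rfl⟩) (hsplit y hy), add_zero] at hxy
    obtain ⟨B, hB, hB', hBf⟩ := exists_commSubalgebra_highOddPart hn hDh hDodd hsq
    have hAB : A ≤ B := by
      have hCD : oddImage A ≤ D ⊔ highOddPart F n := fun x hx => by
        rw [← proj_add_proj_compl {X | X.card = h} x]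
        exact Submodule.add_mem_sup ⟨x, hx, rfl⟩ (hsplit x hx)
      exact fun x hx => hB.ge (sup_le_sup_left hCD (evenPart F n) (le_evenPart_sup_oddImage A hx))
    have hEq : A = B := le_antisymm hAB (hA.isMaximalComm.2 hB' hAB)
    have hAf := ((isMaxDimComm_iff (isGreatest_commDims_odd hF hn)).mp hA).2
    refine ⟨D, hDh, hsq, ?_, ?_⟩
    · rw [hEq, hBf, hmax] at hAf
      omega
    · rw [hEq, hB, sup_assoc]
  · rintro ⟨D, hDh, hsq, hDf, hA⟩
    have hDodd : D ≤ oddPart F n := by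
      by_cases hh : Odd h
      · refine hDh.trans ?_
        rw [component_eq_monSpan]
        exact monSpan_mono fun X (hX : X.card = h) => show Odd X.card from hX.symm ▸ hh
      · rw [if_neg hh] at hDf
        rw [Submodule.finrank_eq_zero.mp hDf]
        exact bot_le
    obtain ⟨B, hB, hB', hBf⟩ := exists_commSubalgebra_highOddPart hn hDh hDodd hsq
    have hEq : A = B := NonUnitalSubalgebra.toSubmodule_injective (by rw [hA, hB, sup_assoc])
    rw [isMaxDimComm_iff (isGreatest_commDims_odd hF hn), hEq, hBf, hDf, hmax]
    exact ⟨hB', by omega⟩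

end Odd

/-! ### Non-isomorphic and non-extremal maximal subalgebras. -/

section NonIsomorphic

theorem exists_isMaximalComm_mon (F : Type*) [Field F] {n : ℕ} (a : Fin n) :
    ∃ A : NonUnitalSubalgebra F (Grassmann F n), IsMaximalComm A ∧ mon F n {a} ∈ A := by
  obtain ⟨A, hA, hA'⟩ := exists_commSubalgebra
    (isSquareZero_monSpan (F := F) (S := {({a} : Finset (Fin n))}) ⟨by simp, by simp⟩)
  obtain ⟨B, hAB, hB⟩ := exists_isMaximalComm_ge hA'
  exact ⟨B, hB, hAB (hA (Submodule.mem_sup_right (mon_mem_monSpan.mpr (by simp))))⟩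

theorem exists_isMaximalComm_compl (F : Type*) [Field F] {n : ℕ} (hn : Even n) (h2 : 2 < n) :
    ∃ A : NonUnitalSubalgebra F (Grassmann F n), IsMaximalComm A ∧
      ∀ i, mon F n {i}ᶜ ∈ A := by
  obtain ⟨A, hA, hA'⟩ := exists_commSubalgebra
    (isSquareZero_monSpan (F := F) (n := n) (S := Finset.univ.image fun i => {i}ᶜ) ⟨by
      intro X hX Y hY
      obtain ⟨i, -, rfl⟩ := Finset.mem_image.mp hX
      obtain ⟨j, -, rfl⟩ := Finset.mem_image.mp hY
      -- Two complements of points together miss at most two points, fewer than `n`.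
      rw [← Finset.compl_union, ← Finset.card_pos, Finset.card_compl, Fintype.card_fin]
      have : ({i} ∪ {j} : Finset (Fin n)).card ≤ 2 := Finset.card_le_two
      omega, by
      intro X hX
      obtain ⟨i, -, rfl⟩ := Finset.mem_image.mp hX
      rw [odd_card_compl hn]
      simp⟩)
  obtain ⟨B, hAB, hB⟩ := exists_isMaximalComm_ge hA'
  exact ⟨B, hB, fun i => hAB (hA (Submodule.mem_sup_right (mon_mem_monSpan.mpr (by simp))))⟩

theorem coef_oddProj {X : Finset (Fin n)} (hX : Odd X.card) (x : Grassmann F n) :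
    coef X (oddProj F n x) = coef X x := by
  classical
  rw [oddProj, coef_proj]
  exact if_pos hX

theorem IsCommSubalgebra.coef_eq_zero (hF : ringChar F ≠ 2)
    {A : NonUnitalSubalgebra F (Grassmann F n)} (hA : IsCommSubalgebra A)
    {X Z : Finset (Fin n)} (hX : mon F n X ∈ A) (hXo : Odd X.card) (hZ : Odd Z.card)
    (hd : Disjoint X Z) {x : Grassmann F n} (hx : x ∈ A) : coef Z x = 0 := by
  rw [← coef_oddProj hZ]
  exact coef_eq_zero_of_mon_mul hd (isSquareZero_oddImage hF hA _
    (mem_oddImage hX (mon_mem_monSpan.mpr hXo)) _ ⟨x, hx, rfl⟩)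

/-- The sets missing at most one point, and not missing `a`. -/
def cofaces (a : Fin n) : Finset (Finset (Fin n)) :=
  Finset.univ.image fun i => if i = a then Finset.univ else {i}ᶜ

theorem card_cofaces_le (a : Fin n) : (cofaces a).card ≤ n :=
  Finset.card_image_le.trans (by simp)

/-- The condition `hev` makes `x` a common eigenvector of multiplication by `A`. Degree 2 monomials
square to zero, so they kill `x` and remove all coordinates missing two or more points; the element
`mon F n {a}` removes the coordinate at `{a}ᶜ`. At most `n` coordinates are left. -/
theorem mem_monSpan_cofaces (hF : ringChar F ≠ 2) (hn : Even n)
    {A : NonUnitalSubalgebra F (Grassmann F n)} (hA : IsMaximalComm A) {a : Fin n}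
    (ha : mon F n {a} ∈ A) {x : Grassmann F n} (hx : x ∈ A)
    (hev : ∀ y ∈ A, ∃ r : F, y * x = r • x) :
    x ∈ monSpan F (cofaces a : Set (Finset (Fin n))) := by
  intro Z hZ
  rcases Nat.lt_or_ge Zᶜ.card 2 with hc | hc
  · have hcases : Zᶜ.card = 0 ∨ Zᶜ.card = 1 := by omega
    rcases hcases with h0 | h1
    · rw [Finset.card_eq_zero, Finset.compl_eq_empty_iff] at h0
      exact absurd (Finset.mem_image.mpr ⟨a, Finset.mem_univ _, by simp [h0]⟩) hZ
    · obtain ⟨i, hi⟩ := Finset.card_eq_one.mp h1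
      rw [compl_eq_comm] at hi
      subst hi
      by_cases hia : i = a
      · subst hia
        exact hA.1.coef_eq_zero hF ha (by simp) ((odd_card_compl hn).mpr (by simp))
          disjoint_compl_right hx
      · exact absurd (Finset.mem_image.mpr ⟨i, Finset.mem_univ _, by simp [hia]⟩) hZ
  · obtain ⟨X, hXZ, hX⟩ := Finset.exists_subset_card_eq hc
    have hXA : mon F n X ∈ A := hA.evenPart_le hF (by
      rw [evenPart_eq_monSpan, mon_mem_monSpan]
      exact show Even X.card from hX.symm ▸ even_two)
    obtain ⟨r, hr⟩ := hev _ hXA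
    have hXX : mon F n X * mon F n X = 0 := mon_mul_of_not_disjoint fun hd => by
      rw [disjoint_self.mp hd] at hX
      simp at hX
    have h2 : (r * r) • x = 0 := by
      rw [mul_smul, ← hr, ← mul_smul_comm, ← hr, ← mul_assoc, hXX, zero_mul]
    refine coef_eq_zero_of_mon_mul (X := X)
      (disjoint_compl_left.mono_left hXZ) ?_
    rw [hr]
    rcases smul_eq_zero.mp h2 with h | h
    · rw [mul_self_eq_zero.mp h, zero_smul]
    · rw [h, smul_zero]

/-- The elements `mon F n {i}ᶜ` rule out degree 1 terms in `A`, so beyond its scalar part every `y`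
starts in degree 2 and kills degrees `n - 1` and `n`. -/
theorem exists_mul_eq_smul (hF : ringChar F ≠ 2) (hn : Even n) (hpos : 2 < n)
    {A : NonUnitalSubalgebra F (Grassmann F n)} (hA : IsMaximalComm A)
    (ha : ∀ i, mon F n {i}ᶜ ∈ A) {x y : Grassmann F n} (hy : y ∈ A)
    (hx : x ∈ monSpan F {X | X.card ∈ ({n - 1, n} : Finset ℕ)}) : ∃ r : F, y * x = r • x := by
  obtain ⟨r, hr⟩ := exists_proj_eq_algebraMap y
  refine ⟨r, ?_⟩
  rw [← proj_add_proj_compl {X | X.card = 0} y, hr, add_mul, ← Algebra.smul_def, add_eq_left]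
  have hy' : proj F {X | X.card = 0}ᶜ y ∈ monSpan F {X | 2 ≤ X.card} := by
    refine proj_compl_mem (T := {X | X.card ≠ 1}) (fun X hX => ?_) fun X hX => ?_
    · obtain ⟨i, rfl⟩ := Finset.card_eq_one.mp (not_not.mp hX)
      exact hA.1.coef_eq_zero hF (ha i) ((odd_card_compl hn).mpr (by simp)) (by simp)
        disjoint_compl_left hy
    · have h1 : X.card ≠ 1 := hX
      change X.card = 0 ∨ 2 ≤ X.card
      omega
  refine mul_eq_zero_of_monSpan hy' hx fun X hX Y hY hd => ?_
  have hc := Finset.card_le_univ (X ∪ Y)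
  rw [Finset.card_union_of_disjoint hd, Fintype.card_fin] at hc
  have h1 : 2 ≤ X.card := hX
  have h2 : Y.card = n - 1 ∨ Y.card = n := by simpa using hY
  omega

theorem monSpan_le_of_compl_mem (hF : ringChar F ≠ 2) (hn : Even n)
    {A : NonUnitalSubalgebra F (Grassmann F n)} (hA : IsMaximalComm A)
    (ha : ∀ i, mon F n {i}ᶜ ∈ A) :
    monSpan F {X | X.card ∈ ({n - 1, n} : Finset ℕ)} ≤ A.toSubmodule := by
  rw [monSpan_eq_span, Submodule.span_le]
  rintro _ ⟨X, hX, rfl⟩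
  have hX' : X.card = n - 1 ∨ X.card = n := by simpa using hX
  by_cases he : X.card = n
  · exact hA.evenPart_le hF (by
      rw [evenPart_eq_monSpan, mon_mem_monSpan]
      exact show Even X.card from he.symm ▸ hn)
  · have hle : X.card ≤ n := by simpa using Finset.card_le_univ X
    have hc : Xᶜ.card = 1 := by
      rw [Finset.card_compl, Fintype.card_fin]
      omega
    obtain ⟨i, hi⟩ := Finset.card_eq_one.mp hc
    rw [compl_eq_comm] at hi
    exact hi ▸ ha i

theorem exists_not_areIsomorphic (hF : ringChar F ≠ 2) (hn : Even n) (h2 : 2 < n) :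
    ∃ A B : NonUnitalSubalgebra F (Grassmann F n),
      IsMaximalComm A ∧ IsMaximalComm B ∧ ¬ AreIsomorphic A B := by
  let a : Fin n := ⟨0, by omega⟩
  obtain ⟨A, hA, haA⟩ := exists_isMaximalComm_mon F a
  obtain ⟨B, hB, hBc⟩ := exists_isMaximalComm_compl F hn h2
  refine ⟨A, B, hA, hB, ?_⟩
  rintro ⟨f, hf⟩
  let e : A ≃ₗ[F] B := LinearEquiv.ofBijective (f : A →ₗ[F] B) hf
  have he : ∀ x, e x = f x := fun _ => rfl
  -- All of `V`, of dimension `n + 1`, consists of common eigenvectors for `B`. An isomorphism would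
  -- embed it among those of `A`, which span at most `n` dimensions.
  let V := monSpan F {X : Finset (Fin n) | X.card ∈ ({n - 1, n} : Finset ℕ)}
  have hVB : V ≤ B.toSubmodule := monSpan_le_of_compl_mem hF hn hB hBc
  let g : V →ₗ[F] Grassmann F n :=
    A.toSubmodule.subtype ∘ₗ (e.symm : B →ₗ[F] A) ∘ₗ Submodule.inclusion hVB
  have hg : ∀ v, g v ∈ monSpan F (cofaces a : Set (Finset (Fin n))) := by
    intro v
    let x : A := e.symm ⟨v, hVB v.2⟩
    refine mem_monSpan_cofaces hF hn hA haA x.2 fun y hy => ?_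
    obtain ⟨r, hr⟩ := exists_mul_eq_smul hF hn h2 hB hBc (f ⟨y, hy⟩).2 v.2
    refine ⟨r, ?_⟩
    have hx : f x = ⟨v, hVB v.2⟩ := e.apply_symm_apply _
    have : (⟨y, hy⟩ : A) * x = r • x := by
      refine hf.1 ?_
      rw [map_mul, map_smul, hx]
      exact Subtype.ext hr
    exact congrArg Subtype.val this
  have hinj : Function.Injective (g.codRestrict _ hg) := by
    intro v w hvw
    have h1 : g v = g w := by
      simpa only [LinearMap.codRestrict_apply] using congrArg Subtype.val hvw
    have h3 : (⟨v, hVB v.2⟩ : B) = ⟨w, hVB w.2⟩ := e.symm.injective (Subtype.ext h1)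
    exact Subtype.ext (congrArg (fun b : B => (b : Grassmann F n)) h3)
  have hfin := LinearMap.finrank_le_finrank_of_injective hinj
  rw [finrank_monSpan] at hfin
  have hV : finrank F V = n + 1 := by
    rw [finrank_monSpan_setOf, card_filter_card_mem, Finset.sum_pair (by omega), Nat.choose_self,
      Nat.choose_symm (by omega : 1 ≤ n), Nat.choose_one_right]
  have := card_cofaces_le a
  omega

/-- A maximal subalgebra through a degree 1 monomial cannot have its odd part in degrees at least
`h`, as `n ≥ 5` means `h ≥ 2`. -/
theorem exists_isMaximalComm_not_isMaxDimComm (hF : ringChar F ≠ 2) (hn : Odd n) (h5 : 5 ≤ n) :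
    ∃ A : NonUnitalSubalgebra F (Grassmann F n), IsMaximalComm A ∧ ¬ IsMaxDimComm A := by
  obtain ⟨h, hh⟩ := hn
  obtain ⟨A, hA, haA⟩ := exists_isMaximalComm_mon F (⟨0, by omega⟩ : Fin n)
  refine ⟨A, hA, fun hmax => ?_⟩
  have h1 := mem_oddImage haA (mon_mem_monSpan.mpr (by simp))
  have h2 := mon_mem_monSpan.mp (oddImage_le_of_isMaxDimComm hF hh hmax h1)
  have h3 := h2.2
  rw [Finset.card_singleton] at h3
  omega

end NonIsomorphic

end Grassmann

theorem theorem6p1 (F : Type*) [Field F] (hF : ringChar F ≠ 2) (n : ℕ) :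
    -- the maximal dimension
    ((∃ m : ℕ, IsGreatest (oddIntersectingSizes n) m ∧
        IsGreatest (Grassmann.commDims F n)
          (Module.finrank F (Grassmann.evenPart F n) + m)) ∧
      (Even n → 2 ≤ n → IsGreatest (Grassmann.commDims F n) (3 * 2 ^ (n - 2))) ∧
      (∀ k : ℕ, n = 4 * k + 1 →
        IsGreatest (Grassmann.commDims F n)
          (2 ^ (n - 1) + ∑ l ∈ Finset.Icc k (2 * k), n.choose (2 * l + 1))) ∧
      (∀ k : ℕ, n = 4 * k + 3 →
        IsGreatest (Grassmann.commDims F n)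
          (2 ^ (n - 1) + (n - 1).choose (2 * k) +
            ∑ l ∈ Finset.Icc k (2 * k), n.choose (2 * l + 3)))) ∧
    -- maximal commutative subalgebras for even `n`
    ((Even n → ∀ A B : NonUnitalSubalgebra F (Grassmann F n),
        Grassmann.IsMaximalComm A → Grassmann.IsMaximalComm B →
          Module.finrank F A = Module.finrank F B) ∧
      (Even n → 2 < n → ∃ A B : NonUnitalSubalgebra F (Grassmann F n),
        Grassmann.IsMaximalComm A ∧ Grassmann.IsMaximalComm B ∧
          ¬ Grassmann.AreIsomorphic A B)) ∧
    -- the maximal dimensional one for `n = 4 k + 1`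
    (∀ k : ℕ, n = 4 * k + 1 →
      ∃ A : NonUnitalSubalgebra F (Grassmann F n),
        A.toSubmodule = Grassmann.evenPart F n ⊔ Grassmann.highOddPart F n ∧
        ∀ B : NonUnitalSubalgebra F (Grassmann F n), Grassmann.IsMaxDimComm B ↔ B = A) ∧
    -- the maximal dimensional ones for `n = 4 k + 3`
    (∀ k : ℕ, n = 4 * k + 3 →
      ∀ W : Submodule F (Grassmann F n),
        (∃ A : NonUnitalSubalgebra F (Grassmann F n),
            Grassmann.IsMaxDimComm A ∧ A.toSubmodule = W) ↔
          ∃ C : Submodule F (Grassmann F n),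
            C ≤ Grassmann.component F n (2 * k + 1) ∧ Grassmann.IsSquareZero C ∧
            Module.finrank F C = (n - 1).choose (2 * k) ∧
            W = Grassmann.evenPart F n ⊔ C ⊔ Grassmann.highOddPart F n) ∧
    -- smaller maximal commutative subalgebras for odd `n`
    (Odd n → 5 ≤ n → ∃ A : NonUnitalSubalgebra F (Grassmann F n),
      Grassmann.IsMaximalComm A ∧ ¬ Grassmann.IsMaxDimComm A) := by
  open Grassmann in
  refine ⟨⟨?_, fun hn h2 => ?_, fun k hk => ?_, fun k hk => ?_⟩, ⟨fun hn A B hA hB => ?_,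
    exists_not_areIsomorphic hF⟩, fun k hk => ?_, fun k hk W => ?_,
    exists_isMaximalComm_not_isMaxDimComm hF⟩
  · obtain ⟨m, hm⟩ := exists_isGreatest_oddIntersectingSizes n
    exact ⟨m, hm, isGreatest_commDims hF hm⟩
  · have h := isGreatest_commDims hF (isGreatest_oddIntersectingSizes_even hn h2)
    rw [finrank_evenPart (by omega)] at h
    convert h using 1
    obtain ⟨m, rfl⟩ := Nat.exists_eq_add_of_le' h2
    rw [show m + 2 - 1 = m + 1 by omega, Nat.add_sub_cancel, pow_succ]
    ring
  · have h := isGreatest_commDims_odd (F := F) (h := 2 * k) hF (by omega : n = 2 * (2 * k) + 1)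
    rwa [finrank_evenPart (by omega), maxOddSize_two_mul, ← hk] at h
  · have h := isGreatest_commDims_odd (F := F) (h := 2 * k + 1) hF
      (by omega : n = 2 * (2 * k + 1) + 1)
    rw [finrank_evenPart (by omega), maxOddSize_two_mul_add_one, ← hk, ← add_assoc] at h
    rwa [show n - 1 = 4 * k + 2 by omega] at h ⊢
  · have h1 := hA.two_mul_finrank hF hn
    have h2 := hB.two_mul_finrank hF hn
    omega
  · have hn : n = 2 * (2 * k) + 1 := by omega
    obtain ⟨A, hA, -⟩ := exists_commSubalgebra_highOddPart (F := F) (D := ⊥) hn bot_le bot_le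
      (fun x hx y _ => by rw [(Submodule.mem_bot F).mp hx, zero_mul])
    rw [bot_sup_eq] at hA
    refine ⟨A, hA, fun B => ?_⟩
    -- Here `h = 2 * k` is even, so the middle layer has dimension 0 and the subalgebra is unique.
    rw [isMaxDimComm_iff_odd hF hn, if_neg (by simp)]
    constructor
    · rintro ⟨D, -, -, hD, hB⟩
      rw [Submodule.finrank_eq_zero.mp hD, sup_bot_eq] at hB
      exact NonUnitalSubalgebra.toSubmodule_injective (hB.trans hA.symm)
    · rintro rfl
      refine ⟨⊥, bot_le, fun x hx y _ => ?_, finrank_bot F _, by rw [sup_bot_eq, hA]⟩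
      rw [(Submodule.mem_bot F).mp hx, zero_mul]
  · have hn : n = 2 * (2 * k + 1) + 1 := by omega
    have hc : (if Odd (2 * k + 1) then (2 * (2 * k + 1)).choose (2 * k + 1 - 1) else 0) =
        (n - 1).choose (2 * k) := by
      rw [if_pos (by simp), hn, Nat.add_sub_cancel, Nat.add_sub_cancel]
    constructor
    · rintro ⟨A, hA, rfl⟩
      obtain ⟨D, hD, hsq, hf, hAD⟩ := (isMaxDimComm_iff_odd hF hn).mp hA
      exact ⟨D, hD, hsq, hf.trans hc, hAD⟩
    · rintro ⟨D, hD, hsq, hf, rfl⟩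
      have hDodd : D ≤ oddPart F n := by
        refine hD.trans ?_
        rw [component_eq_monSpan]
        exact monSpan_mono fun X (hX : X.card = 2 * k + 1) => ⟨k, hX⟩
      obtain ⟨A, hA, -⟩ := exists_commSubalgebra_highOddPart hn hD hDodd hsq
      rw [← sup_assoc] at hA
      exact ⟨A, (isMaxDimComm_iff_odd hF hn).mpr ⟨D, hD, hsq, hf.trans hc.symm, hA⟩, hA⟩
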